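/- Let $F$ be a field with $\operatorname{char} F\neq 2$, let $V$ be a $4$-dimensional vector space over $F$, let $h$ be a symmetric bilinear form on $V$ that is anisotropic (i.e. $h(v,v)\neq 0$ for $v\neq 0$), and fix an $F$-linear isomorphism $b\colon \Lambda^4V\to F$. On $\Lambda^2V$ consider the forms $\Lambda^2h$ and $\mathrm{Pf}$ given by $\Lambda^2h(v_1\wedge v_2,w_1\wedge w_2)=\det(h(v_i,w_j))$ and $\mathrm{Pf}(x,y)=b(x\wedge y)$, and the Hodge operator $J$ defined by $\mathrm{Pf}(J(x),y)=\Lambda^2h(x,y)$. Then $J^2=\delta\,\mathrm{id}$ with $\delta=\det(h(v_i,v_j))/b(v_1\wedge v_2\wedge v_3\wedge v_4)^2$ for any basis $v_1,\dots,v_4$ of $V$. Let $K=F\oplus \boldsymbol{j}F$ be the commutative $F$-algebra with $\boldsymbol{j}^2=\delta$; via $x\,\boldsymbol{j}=J(x)$, the space $\Lambda^2V$ becomes a $K$-module, and $g(x,y)=\Lambda^2h(x,y)+\boldsymbol{j}\,\mathrm{Pf}(x,y)$ is a symmetric $K$-bilinear form on it. Assume that $K$ is not split, i.e. that $K$ has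 no divisors of zero; then $K$ is a field and $\dim_K\Lambda^2V=3$. Let $\mathrm{SO}(\cdot)$ denote the group of linear isometries of determinant $1$, and let $\eta\colon\lambda\mapsto\Lambda^2\lambda$. Let $\Gamma\mathrm{O}(\Lambda^2V,g)$ be the group of semi-similitudes of $g$, i.e. of all additive bijections $f$ of $\Lambda^2V$ for which there are $r\in K^\times$ and a field automorphism $\varphi$ of $K$ with $\varphi(F)=F$ such that $f(xc)=f(x)\varphi(c)$ and $g(f(x),f(y))=r\,\varphi(g(x,y))$ for all $x,y\in\Lambda^2V$ and $c\in K$. A half-turn is an involution in $\mathrm{SO}(\Lambda^2V,g)$ whose space of fixed points, its axis, has codimension $2$ over $K$. An axis meets the Klein quadric if it contains some $X\neq0$ with $\mathrm{Pf}(X,X)=0$. Let $H\le \mathrm{SO}(\Lambda^2V,g)$ be the subgroup generated by all half-turns whose axes meet the Klein quadric. Then $H$ is a normal subgroup of $\Gamma\mathrm{O}(\Lambda^2V,g)$, and $H\le\eta(\mathrm{SO}(V,h))\le\mathrm{SO}(\Lambda^2V,g)$. In general, both $H$ and $\eta(\mathrm{SO}(V,h))$ are proper subgroups of $\mathrm{SO}(\Lambda^2V,g)$: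 for $F=\mathbb Q$, $V=\mathbb Q^4$ and $h(x,y)=x_1y_1+2x_2y_2+10x_3y_3-5x_4y_4$ (and any $b$), the form $h$ is anisotropic, $K$ is not split, and both $H$ and $\eta(\mathrm{SO}(V,h))$ are different from $\mathrm{SO}(\Lambda^2V,g)$. -/

import Mathlib

open Module

/-! ## Groups attached to a bilinear form -/

/-- `SO(W, g)`: the `K`-linear isometries of the bilinear form `g` that have determinant `1`. -/
def specialOrthogonal {K W : Type*} [CommRing K] [AddCommGroup W] [Module K W]
    (g : LinearMap.BilinForm K W) : Subgroup (W ≃ₗ[K] W) where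
  carrier := {e | LinearMap.det (e : W →ₗ[K] W) = 1 ∧ ∀ u v, g (e u) (e v) = g u v}
  one_mem' := ⟨LinearMap.det_id, fun _ _ => rfl⟩
  mul_mem' := by
    rintro a c ⟨ha, ha'⟩ ⟨hc, hc'⟩
    refine ⟨?_, fun u v => ?_⟩
    · have : ((a * c : W ≃ₗ[K] W) : W →ₗ[K] W) = (a : W →ₗ[K] W) * (c : W →ₗ[K] W) := rfl
      rw [this, map_mul, ha, hc, one_mul]
    · change g (a (c u)) (a (c v)) = g u v
      rw [ha', hc']
  inv_mem' := by
    rintro a ⟨ha, ha'⟩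
    refine ⟨?_, fun u v => ?_⟩
    · have h1 : (a : W →ₗ[K] W) * ((a⁻¹ : W ≃ₗ[K] W) : W →ₗ[K] W) = 1 := by
        ext x; exact a.apply_symm_apply x
      have h2 := congrArg LinearMap.det h1
      rwa [map_mul, ha, one_mul, map_one] at h2
    · have := ha' (a.symm u) (a.symm v)
      rw [a.apply_symm_apply, a.apply_symm_apply] at this
      exact this.symm

/-- `ΓO(W, g)` for a form `g` over an extension `K` of `F`, as a group of permutations of `W`: the
additive bijections `f` of `W` for which there are a ring automorphism `φ` of `K` mapping `F` onto
itself (it restricts to an automorphism `ψ` of `F`) and a unit `r` of `K` such that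
`f (c • w) = φ c • f w` and `g (f u) (f v) = r * φ (g u v)`. -/
def semiSimilitudes (F : Type*) {K W : Type*} [CommRing F] [CommRing K] [Algebra F K]
    [AddCommGroup W] [Module K W] (g : LinearMap.BilinForm K W) : Subgroup (Equiv.Perm W) where
  carrier := {f | (∀ u v : W, f (u + v) = f u + f v) ∧
    ∃ (φ : K ≃+* K) (ψ : F ≃+* F) (r : Kˣ),
      (∀ a : F, φ (algebraMap F K a) = algebraMap F K (ψ a)) ∧
      (∀ (c : K) (w : W), f (c • w) = φ c • f w) ∧
      ∀ u v : W, g (f u) (f v) = r * φ (g u v)}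
  one_mem' := ⟨fun _ _ => rfl, RingEquiv.refl K, RingEquiv.refl F, 1, fun _ => rfl,
    fun _ _ => rfl, fun u v => by simp⟩
  mul_mem' := by
    rintro f f' ⟨h0, φ, ψ, r, h1, h2, h3⟩ ⟨h0', φ', ψ', r', h1', h2', h3'⟩
    refine ⟨fun u v => ?_, φ'.trans φ, ψ'.trans ψ, r * Units.map (φ : K →* K) r', fun a => ?_,
      fun c w => ?_, fun u v => ?_⟩
    · simp [Equiv.Perm.mul_apply, h0', h0]
    · simp [h1, h1']
    · simp [Equiv.Perm.mul_apply, h2', h2]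
    · simp [Equiv.Perm.mul_apply, h3, h3', mul_assoc]
  inv_mem' := by
    rintro f ⟨h0, φ, ψ, r, h1, h2, h3⟩
    refine ⟨fun u v => ?_, φ.symm, ψ.symm, Units.map (φ.symm : K →* K) r⁻¹, fun a => ?_,
      fun c w => ?_, fun u v => ?_⟩
    · rw [Equiv.Perm.inv_eq_iff_eq, h0]
      simp
    · rw [RingEquiv.symm_apply_eq, h1, RingEquiv.apply_symm_apply]
    · rw [Equiv.Perm.inv_eq_iff_eq, h2]
      simp
    · apply φ.injective
      have h4 := h3 (f⁻¹ u) (f⁻¹ v)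
      simp only [Equiv.Perm.inv_def, Equiv.apply_symm_apply] at h4 ⊢
      simp [h4]

/-- `t` is a half-turn of `(W, g)` with axis `A`: an element of `SO(W, g)` that is an involution,
whose space of fixed points is `A`, where `A` has codimension `2`. -/
def IsHalfTurn {K W : Type*} [CommRing K] [AddCommGroup W] [Module K W]
    (g : LinearMap.BilinForm K W) (t : W ≃ₗ[K] W) (A : Submodule K W) : Prop :=
  t ∈ specialOrthogonal g ∧ t ≠ 1 ∧ t * t = 1 ∧ (∀ w, t w = w ↔ w ∈ A) ∧ finrank K (W ⧸ A) = 2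

namespace Hodge

/-! ## The forms on the exterior square of a four-dimensional space -/

section Forms

variable {F V : Type*} [Field F] [AddCommGroup V] [Module F V]

/-- The form `Λ²h`, with `Λ²h (v₁ ∧ v₂) (w₁ ∧ w₂) = det (h vᵢ wⱼ)`. -/
noncomputable def extForm (h : LinearMap.BilinForm F V) : LinearMap.BilinForm F (⋀[F]^2 V) :=
  exteriorPower.pairingDual F V 2 ∘ₗ exteriorPower.map 2 h

/-- The Pfaffian form `Pf x y = b (x ∧ y)`. -/
noncomputable def pfaffian (b : ⋀[F]^4 V ≃ₗ[F] F) : LinearMap.BilinForm F (⋀[F]^2 V) :=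
  LinearMap.mk₂ F (fun x y => b ⟨(x : ExteriorAlgebra F V) * (y : ExteriorAlgebra F V), by
      have := Submodule.mul_mem_mul x.2 y.2
      rwa [← pow_add] at this⟩)
    (fun x x' y => by
      rw [← map_add]; congr 1; ext; simp [add_mul])
    (fun c x y => by
      rw [← map_smul]; congr 1; ext; simp)
    (fun x y y' => by
      rw [← map_add]; congr 1; ext; simp [mul_add])
    (fun c x y => by
      rw [← map_smul]; congr 1; ext; simp)

theorem pfaffian_apply (b : ⋀[F]^4 V ≃ₗ[F] F) (x y : Fin 2 → V) :
    pfaffian b (exteriorPower.ιMulti F 2 x) (exteriorPower.ιMulti F 2 y) =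
      b (exteriorPower.ιMulti F 4 ![x 0, x 1, y 0, y 1]) := by
  simp only [pfaffian, LinearMap.mk₂_apply]
  congr 1
  ext
  simp [ExteriorAlgebra.ιMulti_apply, mul_assoc, Matrix.vecTail]

theorem extForm_apply (h : LinearMap.BilinForm F V) (x y : Fin 2 → V) :
    extForm h (exteriorPower.ιMulti F 2 x) (exteriorPower.ιMulti F 2 y) =
      h (x 0) (y 0) * h (x 1) (y 1) - h (x 0) (y 1) * h (x 1) (y 0) := by
  have := exteriorPower.pairingDual_ιMulti_ιMulti (R := F) (M := V) (h ∘ x) y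
  simp only [extForm, LinearMap.comp_apply, exteriorPower.map_apply_ιMulti]
  rw [this, Matrix.det_fin_two]
  simp only [Matrix.of_apply, Function.comp_apply]
  ring

theorem pfaffian_basis (b : ⋀[F]^4 V ≃ₗ[F] F) (v : Basis (Fin 4) F V) (i j k l : Fin 4) :
    pfaffian b (exteriorPower.ιMulti F 2 ![v i, v j]) (exteriorPower.ιMulti F 2 ![v k, v l]) =
      b (exteriorPower.ιMulti F 4 v) *
        (Matrix.of fun p q : Fin 4 => if ![i, j, k, l] q = p then (1 : F) else 0).det := by
  rw [pfaffian_apply]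
  have h1 := (b.toLinearMap.compAlternatingMap (exteriorPower.ιMulti F 4)).eq_smul_basis_det v
  have h2 := congrArg (fun f => f ![v i, v j, v k, v l]) h1
  simp only [LinearMap.compAlternatingMap_apply, LinearEquiv.coe_coe, AlternatingMap.smul_apply,
    smul_eq_mul, Basis.det_apply] at h2
  simp only [Matrix.cons_val_zero, Matrix.cons_val_one]
  rw [h2]
  congr 2
  ext p q
  fin_cases q <;> simp [Basis.toMatrix_apply, Finsupp.single_apply] <;> congr

/-- The sign of `(i, j, k, l)` as an arrangement of `(0, 1, 2, 3)`; zero if there are repetitions. -/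
def eps (i j k l : Fin 4) : ℤ :=
  ((j : ℤ) - i) * ((k : ℤ) - i) * ((l : ℤ) - i) * ((k : ℤ) - j) * ((l : ℤ) - j) * ((l : ℤ) - k) / 12

theorem eps_swap : ∀ i j k l : Fin 4, eps i j k l = eps k l i j := by
  decide +kernel

theorem det_eq_eps : ∀ i j k l : Fin 4,
    (Matrix.of fun p q : Fin 4 => if ![i, j, k, l] q = p then (1 : ℤ) else 0).det =
      eps i j k l := by
  decide +kernel

theorem pfaffian_eps (b : ⋀[F]^4 V ≃ₗ[F] F) (v : Basis (Fin 4) F V) (i j k l : Fin 4) :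
    pfaffian b (exteriorPower.ιMulti F 2 ![v i, v j]) (exteriorPower.ιMulti F 2 ![v k, v l]) =
      b (exteriorPower.ιMulti F 4 v) * (eps i j k l : F) := by
  rw [pfaffian_basis, ← det_eq_eps, Int.cast_det]
  congr 2
  ext p q
  simp

theorem ext_two {N : Type*} [AddCommGroup N] [Module F N] (v : Basis (Fin 4) F V)
    {f g : ⋀[F]^2 V →ₗ[F] N}
    (H : ∀ i j : Fin 4, i < j → f (exteriorPower.ιMulti F 2 ![v i, v j]) =
      g (exteriorPower.ιMulti F 2 ![v i, v j])) : f = g := by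
  apply exteriorPower.linearMap_ext
  apply v.ext_alternating
  intro c hc
  have hc' : (fun i => v (c i)) = ![v (c 0), v (c 1)] := by
    ext i; fin_cases i <;> rfl
  have hne : c 0 ≠ c 1 := fun h => by simpa using hc h
  rw [hc', LinearMap.compAlternatingMap_apply, LinearMap.compAlternatingMap_apply]
  rcases lt_or_gt_of_ne hne with h | h
  · exact H _ _ h
  · have hs : exteriorPower.ιMulti F 2 ![v (c 0), v (c 1)] =
        - exteriorPower.ιMulti F 2 ![v (c 1), v (c 0)] := by
      have := (exteriorPower.ιMulti F 2).map_swap ![v (c 1), v (c 0)] (i := 0) (j := 1) (by simp)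
      rw [← this]
      congr 1
      ext i; fin_cases i <;> simp
    rw [hs, map_neg, map_neg, H _ _ h]

/-- A bivector, expanded in a basis by means of the Pfaffian form. -/
theorem expand (b : ⋀[F]^4 V ≃ₗ[F] F) (v : Basis (Fin 4) F V) (x : ⋀[F]^2 V) :
    b (exteriorPower.ιMulti F 4 v) • x =
      pfaffian b x (exteriorPower.ιMulti F 2 ![v 2, v 3]) • exteriorPower.ιMulti F 2 ![v 0, v 1]
      - pfaffian b x (exteriorPower.ιMulti F 2 ![v 1, v 3]) • exteriorPower.ιMulti F 2 ![v 0, v 2]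
      + pfaffian b x (exteriorPower.ιMulti F 2 ![v 1, v 2]) • exteriorPower.ιMulti F 2 ![v 0, v 3]
      + pfaffian b x (exteriorPower.ιMulti F 2 ![v 0, v 3]) • exteriorPower.ιMulti F 2 ![v 1, v 2]
      - pfaffian b x (exteriorPower.ιMulti F 2 ![v 0, v 2]) • exteriorPower.ιMulti F 2 ![v 1, v 3]
      + pfaffian b x (exteriorPower.ιMulti F 2 ![v 0, v 1]) •
        exteriorPower.ιMulti F 2 ![v 2, v 3] := by
  let e (i j : Fin 4) : ⋀[F]^2 V := exteriorPower.ιMulti F 2 ![v i, v j]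
  let P (i j : Fin 4) : ⋀[F]^2 V →ₗ[F] F := (pfaffian b).flip (e i j)
  let T : ⋀[F]^2 V →ₗ[F] ⋀[F]^2 V :=
    (P 2 3).smulRight (e 0 1) - (P 1 3).smulRight (e 0 2) + (P 1 2).smulRight (e 0 3)
    + (P 0 3).smulRight (e 1 2) - (P 0 2).smulRight (e 1 3) + (P 0 1).smulRight (e 2 3)
  have hT : b (exteriorPower.ιMulti F 4 v) • LinearMap.id = T := by
    apply ext_two v
    intro i j hij
    simp only [T, P, e, LinearMap.smul_apply, LinearMap.id_apply, LinearMap.add_apply,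
      LinearMap.sub_apply, LinearMap.smulRight_apply]
    fin_cases i <;> fin_cases j <;> simp at hij <;>
    · simp only [Fin.mk_zero, Fin.mk_one, Fin.reduceFinMk]
      simp [pfaffian_eps, eps]
  exact congrArg (fun f => f x) hT

theorem gram_poly {R : Type*} [CommRing R] (H : Fin 4 → Fin 4 → R) (hs : ∀ p q, H p q = H q p)
    (i j k l : Fin 4) (hij : i < j) (hkl : k < l) :
    (H i 2 * H j 3 - H i 3 * H j 2) * (H 0 k * H 1 l - H 0 l * H 1 k)
      - (H i 1 * H j 3 - H i 3 * H j 1) * (H 0 k * H 2 l - H 0 l * H 2 k)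
      + (H i 1 * H j 2 - H i 2 * H j 1) * (H 0 k * H 3 l - H 0 l * H 3 k)
      + (H i 0 * H j 3 - H i 3 * H j 0) * (H 1 k * H 2 l - H 1 l * H 2 k)
      - (H i 0 * H j 2 - H i 2 * H j 0) * (H 1 k * H 3 l - H 1 l * H 3 k)
      + (H i 0 * H j 1 - H i 1 * H j 0) * (H 2 k * H 3 l - H 2 l * H 3 k) =
    (Matrix.of fun p q => H p q).det * (eps i j k l : R) := by
  have s10 := hs 1 0
  have s20 := hs 2 0
  have s30 := hs 3 0
  have s21 := hs 2 1
  have s31 := hs 3 1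
  have s32 := hs 3 2
  have hdet : (Matrix.of fun p q => H p q).det = _ := Matrix.det_succ_row_zero _
  simp only [Fin.sum_univ_succ, Matrix.det_fin_three] at hdet
  simp [Fin.succAbove, s10, s20, s30, s21, s31, s32] at hdet
  rw [hdet]
  clear hdet
  fin_cases i <;> fin_cases j <;> first | (exfalso; revert hij; decide) | skip
  all_goals fin_cases k <;> fin_cases l <;> first | (exfalso; revert hkl; decide) | skip
  all_goals
    simp only [Fin.mk_zero, Fin.mk_one, Fin.reduceFinMk, s10, s20, s30, s21, s31, s32]
    simp only [eps, Fin.isValue, Fin.coe_ofNat_eq_mod]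
    norm_num
    try ring

theorem vol_ne_zero (b : ⋀[F]^4 V ≃ₗ[F] F) (v : Basis (Fin 4) F V) :
    b (exteriorPower.ιMulti F 4 v) ≠ 0 := by
  intro h0
  have h1 := (b.toLinearMap.compAlternatingMap (exteriorPower.ιMulti F 4)).eq_smul_basis_det v
  have h2 : b.toLinearMap.compAlternatingMap (exteriorPower.ιMulti F 4) = 0 := by
    rw [h1, LinearMap.compAlternatingMap_apply]
    simp [h0]
  have h3 : b.toLinearMap = 0 := by
    apply exteriorPower.linearMap_ext
    rw [h2]
    ext; simp
  have h4 := congrArg (fun f => f (b.symm 1)) h3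
  simp at h4

theorem pfaffian_nondegenerate (b : ⋀[F]^4 V ≃ₗ[F] F) (v : Basis (Fin 4) F V) :
    (pfaffian b).Nondegenerate := by
  have hl : ∀ x, (∀ y, pfaffian b x y = 0) → x = 0 := by
    intro x hx
    have h1 := expand b v x
    simp only [hx, zero_smul, add_zero, sub_zero] at h1
    exact (smul_eq_zero.mp h1).resolve_left (vol_ne_zero b v)
  have : Module.Finite F V := Module.Finite.of_basis v
  exact .ofSeparatingLeft hl

end Forms

/-! ## The Hodge operator -/

/-- A symmetric bilinear form `h` on a vector space `V` of dimension `4` over `F`, together with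
an identification `b` of the top exterior power with `F`. -/
structure Datum (F V : Type*) [Field F] [AddCommGroup V] [Module F V] where
  /-- the form `h` -/
  h : LinearMap.BilinForm F V
  /-- the linear isomorphism `b` -/
  b : ⋀[F]^4 V ≃ₗ[F] F
  symm : h.IsSymm
  finrank_eq : finrank F V = 4

namespace Datum

variable {F V : Type*} [Field F] [AddCommGroup V] [Module F V] (D : Datum F V)

/-- An arbitrarily chosen basis of `V`. -/
noncomputable def basis : Basis (Fin 4) F V :=
  have : Module.Finite F V := Module.finite_of_finrank_pos (by rw [D.finrank_eq]; norm_num)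
  Module.finBasisOfFinrankEq F V D.finrank_eq

/-- The constant `δ = det H / b (v₀ ∧ v₁ ∧ v₂ ∧ v₃) ^ 2`, where `H` is the Gram matrix of `h` with
respect to a basis `v`; see `delta_eq` for the independence of the choice of that basis. -/
noncomputable def delta : F :=
  (Matrix.of fun i j => D.h (D.basis i) (D.basis j)).det /
    D.b (exteriorPower.ιMulti F 4 D.basis) ^ 2

/-- The Hodge operator `J = Pf⁻¹ ∘ Λ²h`. -/
noncomputable def hodge : ⋀[F]^2 V →ₗ[F] ⋀[F]^2 V :=
  have : Module.Finite F V := Module.finite_of_finrank_pos (by rw [D.finrank_eq]; norm_num)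
  (((pfaffian D.b).toDual (pfaffian_nondegenerate D.b D.basis)).symm : _ →ₗ[F] _) ∘ₗ extForm D.h

theorem pfaffian_hodge (x y : ⋀[F]^2 V) : pfaffian D.b (D.hodge x) y = extForm D.h x y := by
  have : Module.Finite F V := Module.finite_of_finrank_pos (by rw [D.finrank_eq]; norm_num)
  have := LinearMap.BilinForm.apply_toDual_symm_apply
    (hB := pfaffian_nondegenerate D.b D.basis) (f := extForm D.h x) y
  exact this

theorem gram_identity (v : Basis (Fin 4) F V) (i j k l : Fin 4) (hij : i < j) (hkl : k < l) :
    let e (p q : Fin 4) : ⋀[F]^2 V := exteriorPower.ιMulti F 2 ![v p, v q]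
    let B := extForm D.h
    B (e i j) (e 2 3) * B (e 0 1) (e k l) - B (e i j) (e 1 3) * B (e 0 2) (e k l)
      + B (e i j) (e 1 2) * B (e 0 3) (e k l) + B (e i j) (e 0 3) * B (e 1 2) (e k l)
      - B (e i j) (e 0 2) * B (e 1 3) (e k l) + B (e i j) (e 0 1) * B (e 2 3) (e k l) =
    (Matrix.of fun p q => D.h (v p) (v q)).det * (eps i j k l : F) := by
  intro e B
  simp only [e, B, extForm_apply, Matrix.cons_val_zero, Matrix.cons_val_one]
  exact gram_poly (fun p q => D.h (v p) (v q)) (fun p q => D.symm.eq _ _) i j k l hij hkl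

theorem extForm_hodge_aux (v : Basis (Fin 4) F V) (x y : ⋀[F]^2 V) :
    D.b (exteriorPower.ιMulti F 4 v) ^ 2 * extForm D.h (D.hodge x) y =
      (Matrix.of fun p q => D.h (v p) (v q)).det * pfaffian D.b x y := by
  have key : D.b (exteriorPower.ιMulti F 4 v) ^ 2 • (extForm D.h ∘ₗ D.hodge) =
      (Matrix.of fun p q => D.h (v p) (v q)).det • pfaffian D.b := by
    apply ext_two v
    intro i j hij
    apply ext_two v
    intro k l hkl
    have h1 := congrArg (fun z => extForm D.h z (exteriorPower.ιMulti F 2 ![v k, v l]))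
      (expand D.b v (D.hodge (exteriorPower.ιMulti F 2 ![v i, v j])))
    simp only [pfaffian_hodge, map_add, map_sub, map_smul, LinearMap.add_apply,
      LinearMap.sub_apply, LinearMap.smul_apply, smul_eq_mul] at h1
    have h2 := D.gram_identity v i j k l hij hkl
    simp only at h2
    rw [h2] at h1
    simp only [LinearMap.smul_apply, LinearMap.comp_apply, smul_eq_mul]
    rw [pow_two, mul_assoc, h1, pfaffian_eps]
    ring
  have := congrArg (fun f => f x y) key
  simpa using this

theorem extForm_hodge (x y : ⋀[F]^2 V) :
    extForm D.h (D.hodge x) y = D.delta * pfaffian D.b x y := by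
  have h0 := vol_ne_zero D.b D.basis
  have h1 := D.extForm_hodge_aux D.basis x y
  rw [delta, div_mul_eq_mul_div, eq_div_iff (pow_ne_zero 2 h0), ← h1]
  ring

/-- The square of the Hodge operator. -/
theorem hodge_hodge (x : ⋀[F]^2 V) : D.hodge (D.hodge x) = D.delta • x := by
  have hn := pfaffian_nondegenerate D.b D.basis
  have : D.hodge (D.hodge x) - D.delta • x = 0 := by
    apply hn.1
    intro y
    rw [map_sub, LinearMap.sub_apply, pfaffian_hodge, extForm_hodge, map_smul,
      LinearMap.smul_apply, smul_eq_mul, sub_self]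
  exact sub_eq_zero.mp this

/-- The constant `δ` may be computed in any basis. -/
theorem delta_eq (v : Basis (Fin 4) F V) :
    D.delta = (Matrix.of fun p q => D.h (v p) (v q)).det /
      D.b (exteriorPower.ιMulti F 4 v) ^ 2 := by
  have h0 := vol_ne_zero D.b v
  have h1 := D.extForm_hodge_aux v (exteriorPower.ιMulti F 2 ![v 0, v 1])
    (exteriorPower.ιMulti F 2 ![v 2, v 3])
  rw [extForm_hodge, pfaffian_eps] at h1
  have h2 : eps 0 1 2 3 = 1 := by decide
  rw [h2, Int.cast_one, mul_one, ← mul_assoc] at h1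
  rw [eq_div_iff (pow_ne_zero 2 h0), mul_comm]
  exact mul_right_cancel₀ h0 h1

/-! ## The exterior square as a space over `K = F ⊕ jF`, `j² = δ` -/

/-- The commutative algebra `K = F ⊕ jF` with `j² = δ`. -/
abbrev K : Type _ := QuadraticAlgebra F D.delta 0

/-- `K` is split if it contains divisors of zero. -/
def IsSplit : Prop := ∃ x y : D.K, x ≠ 0 ∧ y ≠ 0 ∧ x * y = 0

/-- The exterior square `Λ²V`, to be regarded as a module over `K`. -/
def W (_D : Datum F V) : Type _ := ⋀[F]^2 V

noncomputable instance : AddCommGroup D.W := inferInstanceAs (AddCommGroup (⋀[F]^2 V))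

noncomputable instance : Module F D.W := inferInstanceAs (Module F (⋀[F]^2 V))

/-- The identity map from `D.W` to `Λ²V`. -/
noncomputable def ofW : D.W ≃ₗ[F] ⋀[F]^2 V := LinearEquiv.refl F (⋀[F]^2 V)

/-- The action of `K` on `Λ²V` in which `j` acts as the Hodge operator. -/
noncomputable instance : Module D.K D.W where
  smul c x := D.ofW.symm (c.re • D.ofW x + c.im • D.hodge (D.ofW x))
  one_smul x := by
    change D.ofW.symm ((1 : F) • D.ofW x + (0 : F) • D.hodge (D.ofW x)) = x
    simp
  mul_smul c d x := by
    change D.ofW.symm ((c * d).re • D.ofW x + (c * d).im • D.hodge (D.ofW x)) =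
      D.ofW.symm (c.re • D.ofW (D.ofW.symm (d.re • D.ofW x + d.im • D.hodge (D.ofW x))) +
        c.im • D.hodge (D.ofW (D.ofW.symm (d.re • D.ofW x + d.im • D.hodge (D.ofW x)))))
    simp only [LinearEquiv.apply_symm_apply, map_add, map_smul, hodge_hodge,
      QuadraticAlgebra.re_mul, QuadraticAlgebra.im_mul]
    module
  smul_zero c := by
    change D.ofW.symm (c.re • D.ofW 0 + c.im • D.hodge (D.ofW 0)) = 0
    simp
  smul_add c x y := by
    change D.ofW.symm (c.re • D.ofW (x + y) + c.im • D.hodge (D.ofW (x + y))) =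
      D.ofW.symm (c.re • D.ofW x + c.im • D.hodge (D.ofW x)) +
      D.ofW.symm (c.re • D.ofW y + c.im • D.hodge (D.ofW y))
    simp only [map_add, map_smul]
    module
  add_smul c d x := by
    change D.ofW.symm ((c.re + d.re) • D.ofW x + (c.im + d.im) • D.hodge (D.ofW x)) =
      D.ofW.symm (c.re • D.ofW x + c.im • D.hodge (D.ofW x)) +
      D.ofW.symm (d.re • D.ofW x + d.im • D.hodge (D.ofW x))
    simp only [map_add, map_smul]
    module
  zero_smul x := by
    change D.ofW.symm ((0 : F) • D.ofW x + (0 : F) • D.hodge (D.ofW x)) = 0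
    simp

theorem ofW_smul (c : D.K) (x : D.W) :
    D.ofW (c • x) = c.re • D.ofW x + c.im • D.hodge (D.ofW x) := rfl

instance : IsScalarTower F D.K D.W where
  smul_assoc a c x := by
    apply D.ofW.injective
    rw [LinearEquiv.map_smul D.ofW a (c • x), ofW_smul, ofW_smul]
    simp only [QuadraticAlgebra.re_smul, QuadraticAlgebra.im_smul, smul_eq_mul]
    module

theorem pfaffian_symm (x y : ⋀[F]^2 V) : pfaffian D.b x y = pfaffian D.b y x := by
  have key : pfaffian D.b = (pfaffian D.b).flip := by
    apply ext_two D.basis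
    intro i j hij
    apply ext_two D.basis
    intro k l hkl
    rw [LinearMap.BilinForm.flip_apply, pfaffian_eps, pfaffian_eps, eps_swap]
  exact congrArg (fun f => f x y) key

theorem extForm_symm (x y : ⋀[F]^2 V) : extForm D.h x y = extForm D.h y x := by
  have key : extForm D.h = (extForm D.h).flip := by
    apply ext_two D.basis
    intro i j hij
    apply ext_two D.basis
    intro k l hkl
    rw [LinearMap.BilinForm.flip_apply, extForm_apply, extForm_apply]
    simp only [Matrix.cons_val_zero, Matrix.cons_val_one]
    rw [D.symm.eq (D.basis i), D.symm.eq (D.basis j), D.symm.eq (D.basis i) (D.basis l),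
      D.symm.eq (D.basis j)]
    ring
  exact congrArg (fun f => f x y) key

/-- The symmetric `K`-bilinear form `g u v = Λ²h u v + j * Pf u v` on `Λ²V`. -/
noncomputable def g : LinearMap.BilinForm D.K D.W :=
  LinearMap.mk₂ D.K
    (fun u v => (⟨extForm D.h (D.ofW u) (D.ofW v), pfaffian D.b (D.ofW u) (D.ofW v)⟩ : D.K))
    (fun u u' v => by ext <;> simp)
    (fun c u v => by
      ext
      · simp [ofW_smul, extForm_hodge]; ring
      · simp [ofW_smul, pfaffian_hodge])
    (fun u v v' => by ext <;> simp)
    (fun c u v => by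
      ext
      · simp [ofW_smul, D.extForm_symm (D.ofW u) (D.hodge _), extForm_hodge,
          D.pfaffian_symm (D.ofW v) (D.ofW u)]
        ring
      · simp [ofW_smul, D.pfaffian_symm (D.ofW u) (D.hodge _), pfaffian_hodge,
          D.extForm_symm (D.ofW v) (D.ofW u)])

/-! ## The groups -/

/-- `h` is anisotropic. -/
def IsAnisotropic : Prop := ∀ v : V, D.h v v = 0 → v = 0

/-- The submodule `A` of `Λ²V` meets the Klein quadric, whose points are spanned by the nonzero
`X` with `Pf X X = 0`. -/
def MeetsKleinQuadric (A : Submodule D.K D.W) : Prop :=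
  ∃ X ∈ A, X ≠ 0 ∧ pfaffian D.b (D.ofW X) (D.ofW X) = 0

/-- `SO(Λ²V, g)`, as a group of permutations of `Λ²V`. -/
noncomputable def SOext : Subgroup (Equiv.Perm D.W) :=
  (specialOrthogonal D.g).map (MulAction.toPermHom (D.W ≃ₗ[D.K] D.W) D.W)

/-- The group `H` generated by the half-turns of `(Λ²V, g)` whose axes meet the Klein quadric. -/
noncomputable def halfTurnGroup : Subgroup (Equiv.Perm D.W) :=
  (Subgroup.closure {t | ∃ A : Submodule D.K D.W, IsHalfTurn D.g t A ∧ D.MeetsKleinQuadric A}).map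
    (MulAction.toPermHom (D.W ≃ₗ[D.K] D.W) D.W)

/-- The group `ΓO(Λ²V, g)` of semi-similitudes of `g`. -/
noncomputable def gammaOext : Subgroup (Equiv.Perm D.W) := semiSimilitudes F D.g

/-- The homomorphism `η`, mapping `a` to `Λ²a : v ∧ w ↦ a v ∧ a w`. -/
noncomputable def eta : (V ≃ₗ[F] V) →* Equiv.Perm D.W where
  toFun a :=
    { toFun := fun x => D.ofW.symm (exteriorPower.map 2 (a : V →ₗ[F] V) (D.ofW x))
      invFun := fun x => D.ofW.symm (exteriorPower.map 2 (a.symm : V →ₗ[F] V) (D.ofW x))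
      left_inv := fun x => by
        simp only [LinearEquiv.apply_symm_apply]
        rw [← LinearMap.comp_apply, ← exteriorPower.map_comp]
        simp
      right_inv := fun x => by
        simp only [LinearEquiv.apply_symm_apply]
        rw [← LinearMap.comp_apply, ← exteriorPower.map_comp]
        simp }
  map_one' := by
    ext x
    change exteriorPower.map 2 LinearMap.id _ = _
    rw [exteriorPower.map_id]
    rfl
  map_mul' a c := by
    ext x
    change exteriorPower.map 2 ((a : V →ₗ[F] V) ∘ₗ (c : V →ₗ[F] V)) _ =
      exteriorPower.map 2 _ (exteriorPower.map 2 _ _)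
    rw [exteriorPower.map_comp]
    rfl

/-- The image `η(SO(V, h))`. -/
noncomputable def etaSO : Subgroup (Equiv.Perm D.W) := (specialOrthogonal D.h).map D.eta

end Datum

/-- The form `x₁y₁ + 2x₂y₂ + 10x₃y₃ - 5x₄y₄` on `ℚ⁴`. -/
noncomputable def exampleForm : LinearMap.BilinForm ℚ (Fin 4 → ℚ) :=
  Matrix.toBilin' (Matrix.diagonal ![1, 2, 10, -5])

end Hodge

/-! In dimension three over K, a half-turn is y ↦ (2 g(X,y)/g(X,X)) X - y for any nonsingular X on
its axis, and g(X,X) changes by squares of K when X is rescaled. Since Pf(X,X) is the j-component of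
g(X,X), the axis meets the Klein quadric iff some c²g(X,X) with c ≠ 0 lies in F. All three claims
turn on this.

Inclusions. A bivector with Pf(X,X) = 0 is v₀ ∧ v₁ for some orthogonal basis v of V. The v₀ ∧ vᵢ
form a g-orthogonal K-basis of Λ²V, on which the half-turn about X and η of the product of the
reflections in v₂ and v₃ both act as 1, -1, -1 (`eta_reflection_mul_reflection`). This gives H ≤
η(SO(V,h)). Conversely, by Cartan–Dieudonné, SO(V,h) is generated by products of two reflections, in
fact in perpendicular vectors, and η maps these to half-turns, so η(SO(V,h)) ≤ SO(Λ²V,g).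

Normality. A semi-similitude f with multiplier r turns the half-turn about X into the one about
f(X). Comparing Gram determinants in the odd dimension three shows that c²r lies in F for some c ≠ 0
(`exists_sq_mul_multiplier_mem`), so the new axis meets the quadric again.

Properness. If η(a) is a half-turn then a² = ±1, since ker η consists of ±1. The case a² = -1 would
make δ a square. If a² = 1, two perpendicular eigenvectors of a for the same eigenvalue give a
decomposable bivector on the axis. So a half-turn for which no c²g(X,X) with c ≠ 0 lies in F is
outside η(SO(V,h)); over ℚ a norm from K detects one. -/

/-! ## Reflections and half-turns -/

namespace LinearMap.BilinForm

section Reflection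

variable {K W : Type*} [Field K] [AddCommGroup W] [Module K W] (B : LinearMap.BilinForm K W)

/-- The orthogonal reflection in the hyperplane perpendicular to the nonsingular vector `u`. -/
noncomputable def orthReflection (u : W) (hu : B u u ≠ 0) : W ≃ₗ[K] W :=
  Module.reflection (x := u) (f := (2 / B u u) • B u) (by simp [hu])

theorem orthReflection_apply (u : W) (hu : B u u ≠ 0) (y : W) :
    B.orthReflection u hu y = y - (2 * B u y / B u u) • u := by
  simp [orthReflection, Module.reflection_apply, div_mul_eq_mul_div]

theorem orthReflection_mul_self (u : W) (hu : B u u ≠ 0) :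
    B.orthReflection u hu * B.orthReflection u hu = 1 := by
  ext y
  exact Module.involutive_reflection _ y

theorem orthReflection_self (u : W) (hu : B u u ≠ 0) : B.orthReflection u hu u = -u := by
  rw [orthReflection_apply, mul_div_assoc, div_self hu]
  module

theorem orthReflection_of_ortho (u : W) (hu : B u u ≠ 0) {y : W} (hy : B u y = 0) :
    B.orthReflection u hu y = y := by
  rw [orthReflection_apply, hy, mul_zero, zero_div, zero_smul, sub_zero]

variable {B}

theorem orthReflection_isometry (hB : B.IsSymm) (u : W) (hu : B u u ≠ 0) (x y : W) :
    B (B.orthReflection u hu x) (B.orthReflection u hu y) = B x y := by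
  simp only [orthReflection_apply, map_sub, map_smul, LinearMap.sub_apply, LinearMap.smul_apply,
    smul_eq_mul]
  rw [show B x u = B u x from hB.eq x u]
  field_simp
  ring

/-- A reflection is a transvection with functional f = -(2 / B u u) • B u, whose determinant is 1 +
f u = 1 - 2. -/
theorem det_orthReflection [FiniteDimensional K W] (u : W) (hu : B u u ≠ 0) :
    LinearMap.det (B.orthReflection u hu : W →ₗ[K] W) = -1 := by
  have h : (B.orthReflection u hu : W →ₗ[K] W) =
      LinearMap.transvection (-((2 / B u u) • B u)) u := by
    ext y
    simp [orthReflection_apply, LinearMap.transvection.apply, div_mul_eq_mul_div, sub_eq_add_neg]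
  rw [h, LinearMap.transvection.det]
  simp only [LinearMap.neg_apply, LinearMap.smul_apply, smul_eq_mul, div_mul_cancel₀ _ hu]
  norm_num

variable (B) in
/-- The half-turn about the axis spanned by a nonsingular vector `X`. -/
noncomputable def halfTurn (X : W) (hX : B X X ≠ 0) : W ≃ₗ[K] W :=
  (B.orthReflection X hX).trans (LinearEquiv.neg K)

theorem halfTurn_apply (X : W) (hX : B X X ≠ 0) (y : W) :
    B.halfTurn X hX y = (2 * B X y / B X X) • X - y := by
  simp [halfTurn, orthReflection_apply]

theorem halfTurn_self (X : W) (hX : B X X ≠ 0) : B.halfTurn X hX X = X := by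
  simp [halfTurn, orthReflection_self]

theorem halfTurn_of_ortho (X : W) (hX : B X X ≠ 0) {y : W} (hy : B X y = 0) :
    B.halfTurn X hX y = -y := by
  simp [halfTurn_apply, hy]

theorem halfTurn_mul_self (X : W) (hX : B X X ≠ 0) : B.halfTurn X hX * B.halfTurn X hX = 1 := by
  ext y
  have := congrArg (fun t => t y) (B.orthReflection_mul_self X hX)
  simpa [halfTurn] using this

/-- Numerator and denominator both scale by c², so only the line matters. This freedom is what
allows a generator of the axis to be replaced by one on the Klein quadric. -/
theorem halfTurn_smul (X : W) (hX : B X X ≠ 0) (c : K) (hc : B (c • X) (c • X) ≠ 0) :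
    B.halfTurn (c • X) hc = B.halfTurn X hX := by
  have hc0 : c ≠ 0 := by rintro rfl; simp at hc
  ext y
  simp only [halfTurn_apply, map_smul, LinearMap.smul_apply, smul_eq_mul, smul_smul]
  congr 2
  field_simp

/-- The negative of a reflection has determinant (-1)³ · (-1) = 1; the odd dimension is essential.
-/
theorem halfTurn_mem_specialOrthogonal (hB : B.IsSymm) (hd : finrank K W = 3) (X : W)
    (hX : B X X ≠ 0) : B.halfTurn X hX ∈ specialOrthogonal B := by
  have : FiniteDimensional K W := Module.finite_of_finrank_pos (by omega)
  refine ⟨?_, fun u v => ?_⟩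
  · have h : (B.halfTurn X hX : W →ₗ[K] W) = (-1 : K) • (B.orthReflection X hX : W →ₗ[K] W) := by
      ext y
      simp [halfTurn]
    rw [h, LinearMap.det_smul, det_orthReflection, hd]
    norm_num
  · simpa [halfTurn] using orthReflection_isometry hB X hX u v

theorem halfTurn_eq_self_iff (h2 : (2 : K) ≠ 0) (X : W) (hX : B X X ≠ 0) (y : W) :
    B.halfTurn X hX y = y ↔ y ∈ K ∙ X := by
  constructor
  · intro h
    rw [halfTurn_apply, sub_eq_iff_eq_add, ← two_smul K y] at h
    rw [Submodule.mem_span_singleton]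
    refine ⟨2⁻¹ * (2 * B X y / B X X), ?_⟩
    rw [mul_smul, h, smul_smul, inv_mul_cancel₀ h2, one_smul]
  · intro h
    obtain ⟨c, rfl⟩ := Submodule.mem_span_singleton.mp h
    rw [map_smul, halfTurn_self]

theorem isHalfTurn_halfTurn (h2 : (2 : K) ≠ 0) (hB : B.IsSymm) (hd : finrank K W = 3) (X : W)
    (hX : B X X ≠ 0) : IsHalfTurn B (B.halfTurn X hX) (K ∙ X) := by
  have : FiniteDimensional K W := Module.finite_of_finrank_pos (by omega)
  have hX0 : X ≠ 0 := by rintro rfl; simp at hX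
  have hq : finrank K (W ⧸ K ∙ X) = 2 := by
    have h1 := Submodule.finrank_quotient_add_finrank (K ∙ X)
    rw [finrank_span_singleton hX0, hd] at h1
    omega
  refine ⟨halfTurn_mem_specialOrthogonal hB hd X hX, fun h => ?_, halfTurn_mul_self X hX,
    halfTurn_eq_self_iff h2 X hX, hq⟩
  have htop : (K ∙ X) = ⊤ := by
    rw [Submodule.eq_top_iff']
    intro y
    rw [← halfTurn_eq_self_iff h2 X hX, h]
    rfl
  have h1 := finrank_span_singleton (K := K) hX0
  rw [htop, finrank_top, hd] at h1
  omega

/-- A half-turn is determined by any nonsingular vector on its axis. -/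
theorem _root_.IsHalfTurn.eq_halfTurn (hd : finrank K W = 3)
    {t : W ≃ₗ[K] W} {A : Submodule K W} (ht : IsHalfTurn B t A) {X : W} (hXA : X ∈ A)
    (hX : B X X ≠ 0) : t = B.halfTurn X hX := by
  have : FiniteDimensional K W := Module.finite_of_finrank_pos (by omega)
  have hX0 : X ≠ 0 := by rintro rfl; simp at hX
  obtain ⟨⟨-, hiso⟩, -, htt, hfix, hA⟩ := ht
  have hA1 : finrank K A = 1 := by
    have h1 := Submodule.finrank_quotient_add_finrank A
    omega
  have hspan : ∀ y ∈ A, ∃ c : K, c • X = y := by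
    intro y hy
    obtain ⟨c, hc⟩ := exists_smul_eq_of_finrank_eq_one hA1 (x := (⟨X, hXA⟩ : A))
      (by simpa [Subtype.ext_iff] using hX0) ⟨y, hy⟩
    exact ⟨c, congrArg Subtype.val hc⟩
  have htX : t X = X := (hfix X).mpr hXA
  ext y
  -- As t is an involution, t y + y is fixed, hence a multiple of X; pairing with X yields the
  -- coefficient.
  have hy : t y + y ∈ A := by
    rw [← hfix, map_add, add_comm]
    congr 1
    exact congrArg (fun t => t y) htt
  obtain ⟨c, hc⟩ := hspan _ hy
  have h1 : B X (t y) = B X y := by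
    have := hiso X y
    rwa [htX] at this
  have h2 : c * B X X = 2 * B X y := by
    have := congrArg (B X) hc
    rw [map_smul, map_add, h1, smul_eq_mul] at this
    rw [this]; ring
  rw [halfTurn_apply, ← h2, mul_div_cancel_right₀ _ hX, hc, add_sub_cancel_right]

end Reflection

/-! ### Semi-similitudes and their multipliers -/

section SemiSimilitude

variable {F K W : Type*} [CommRing F] [Field K] [Algebra F K] [AddCommGroup W] [Module K W]
  {B : LinearMap.BilinForm K W}

/-- The conjugate of a half-turn under a semi-similitude. -/
theorem semiSimilitude_conj_halfTurn {f : Equiv.Perm W} (hf : ∀ u v : W, f (u + v) = f u + f v)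
    {φ : K ≃+* K} {r : Kˣ} (hsmul : ∀ (c : K) (w : W), f (c • w) = φ c • f w)
    (hsim : ∀ u v : W, B (f u) (f v) = r * φ (B u v)) (X : W) (hX : B X X ≠ 0)
    (hfX : B (f X) (f X) ≠ 0) (y : W) :
    f (B.halfTurn X hX (f⁻¹ y)) = B.halfTurn (f X) hfX y := by
  obtain ⟨y, rfl⟩ := f.surjective y
  have hsub : ∀ u v : W, f (u - v) = f u - f v := fun u v => by
    rw [eq_sub_iff_add_eq, ← hf, sub_add_cancel]
  rw [Equiv.Perm.inv_def, Equiv.symm_apply_apply, halfTurn_apply, halfTurn_apply, hsub, hsmul, hsim, hsim]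
  congr 2
  have h0 : φ (B X X) ≠ 0 := by simpa using hX
  have hr := r.ne_zero
  simp only [map_div₀, map_mul, map_ofNat]
  field_simp

/-- In dimension three the multiplier of a semi-similitude belongs to the square class of an element
of `F`, provided that some Gram determinant is a nonzero element of `F`. -/
theorem exists_sq_mul_multiplier_mem (b : Basis (Fin 3) K W) (d : F)
    (hd : (Matrix.of fun i j => B (b i) (b j)).det = algebraMap F K d) (hd0 : algebraMap F K d ≠ 0)
    {f : W → W} {φ : K ≃+* K} {ψ : F ≃+* F}
    (hφ : ∀ a : F, φ (algebraMap F K a) = algebraMap F K (ψ a)) {r : Kˣ}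
    (hsim : ∀ u v : W, B (f u) (f v) = r * φ (B u v)) :
    ∃ c : K, c ≠ 0 ∧ c ^ 2 * r * algebraMap F K d = algebraMap F K (ψ d) := by
  have hr := r.ne_zero
  -- Row i holds the coordinates of f (b i). Only these three vectors get expanded, so f need not be
  -- linear.
  let M : Matrix (Fin 3) (Fin 3) K := Matrix.of fun i j => b.repr (f (b i)) j
  let G : Matrix (Fin 3) (Fin 3) K := Matrix.of fun i j => B (b i) (b j)
  have hM : M * G * M.transpose = (r : K) • φ.mapMatrix G := by
    ext i j
    simp only [Matrix.smul_apply, RingEquiv.mapMatrix_apply, Matrix.map_apply, smul_eq_mul, G,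
      Matrix.of_apply, ← hsim]
    conv_rhs => rw [← b.sum_repr (f (b i)), ← b.sum_repr (f (b j))]
    simp only [Matrix.mul_apply, M, Matrix.transpose_apply, Matrix.of_apply, map_sum,
      LinearMap.sum_apply, map_smul, LinearMap.smul_apply, smul_eq_mul, Finset.sum_mul,
      Finset.mul_sum]
    refine Finset.sum_congr rfl fun k _ => Finset.sum_congr rfl fun l _ => by ring
  have hdet := congrArg Matrix.det hM
  have hφG : (φ.mapMatrix G).det = algebraMap F K (ψ d) := by
    rw [← hφ, ← hd]
    exact (RingEquiv.map_det φ G).symm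
  rw [Matrix.det_mul, Matrix.det_mul, Matrix.det_transpose, Matrix.det_smul, hφG,
    Fintype.card_fin, show G.det = _ from hd] at hdet
  have hψ : algebraMap F K (ψ d) ≠ 0 := by
    rw [← hφ]; simpa using hd0
  have hM0 : M.det ≠ 0 := by
    intro h0
    rw [h0] at hdet
    simp at hdet
    exact hψ hdet
  -- The determinants satisfy (det M)² d = r³ ψ(d). The exponent 3 is the dimension; being odd, it
  -- leaves one factor r after division by even powers of r.
  refine ⟨M.det / r ^ 2, by positivity, ?_⟩
  field_simp
  rw [← hdet]
  ring

end SemiSimilitude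

end LinearMap.BilinForm

namespace LinearMap.BilinForm

/-! ## Anisotropic forms in dimension four -/

section Anisotropic

variable {F V : Type*} [Field F] [AddCommGroup V] [Module F V] {h : LinearMap.BilinForm F V}

/-- Three linear conditions on a space of dimension four have a nonzero solution. Repeated or zero
entries of s impose fewer conditions: `![u, w, w]` stands for two and `![0, 0, 0]` for none. -/
theorem exists_ne_zero_ortho (hd : finrank F V = 4) (s : Fin 3 → V) :
    ∃ z : V, z ≠ 0 ∧ ∀ i, h (s i) z = 0 := by
  have : FiniteDimensional F V := Module.finite_of_finrank_pos (by omega)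
  have hk := LinearMap.ker_ne_bot_of_finrank_lt (f := LinearMap.pi fun i => h (s i))
    (by rw [hd, finrank_fin_fun]; norm_num)
  obtain ⟨z, hz, hz0⟩ := Submodule.exists_mem_ne_zero_of_ne_bot hk
  exact ⟨z, hz0, fun i => congrFun (LinearMap.mem_ker.mp hz) i⟩

variable (hs : h.IsSymm) (ha : ∀ v, h v v = 0 → v = 0) (hd : finrank F V = 4)

include hs ha hd in
theorem exists_basis_of_ortho {a b c d : V} (ha0 : a ≠ 0) (hb0 : b ≠ 0) (hc0 : c ≠ 0)
    (hd0 : d ≠ 0) (hab : h a b = 0) (hac : h a c = 0) (hbc : h b c = 0) (had : h a d = 0)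
    (hbd : h b d = 0) (hcd : h c d = 0) :
    ∃ v : Basis (Fin 4) F V, (∀ i j, i ≠ j → h (v i) (v j) = 0) ∧ ⇑v = ![a, b, c, d] := by
  have ho : ∀ i j : Fin 4, i ≠ j → h (![a, b, c, d] i) (![a, b, c, d] j) = 0 := by
    have hba : h b a = 0 := (hs.eq a b).symm.trans hab
    have hca : h c a = 0 := (hs.eq a c).symm.trans hac
    have hcb : h c b = 0 := (hs.eq b c).symm.trans hbc
    have hda : h d a = 0 := (hs.eq a d).symm.trans had
    have hdb : h d b = 0 := (hs.eq b d).symm.trans hbd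
    have hdc : h d c = 0 := (hs.eq c d).symm.trans hcd
    intro i j hij
    fin_cases i <;> fin_cases j <;> first | exact absurd rfl hij | assumption
  have hli : LinearIndependent F ![a, b, c, d] := by
    refine LinearMap.BilinForm.linearIndependent_of_iIsOrtho (B := h) (fun i j hij => ho i j hij)
      fun i hi => ?_
    have := ha _ hi
    fin_cases i <;> contradiction
  refine ⟨basisOfLinearIndependentOfCardEqFinrank hli (by simp [hd]), ?_, by simp⟩
  simpa using ho

include hs ha hd in
theorem exists_ortho_basis_extending {u w : V} (hu : u ≠ 0) (hw : w ≠ 0) (huw : h u w = 0) :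
    ∃ v : Basis (Fin 4) F V, (∀ i j, i ≠ j → h (v i) (v j) = 0) ∧ v 0 = u ∧ v 1 = w := by
  obtain ⟨y, hy0, hy⟩ := exists_ne_zero_ortho (h := h) hd ![u, w, w]
  obtain ⟨z, hz0, hz⟩ := exists_ne_zero_ortho (h := h) hd ![u, w, y]
  obtain ⟨v, hv, hv'⟩ := exists_basis_of_ortho hs ha hd hu hw hy0 hz0 huw (hy 0) (hy 1) (hz 0)
    (hz 1) (hz 2)
  exact ⟨v, hv, by rw [hv']; rfl, by rw [hv']; rfl⟩

/-! ### Generation by pairs of reflections -/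

/-- The group generated by all products of two reflections. -/
noncomputable def reflectionPairs (h : LinearMap.BilinForm F V) : Subgroup (V ≃ₗ[F] V) :=
  Subgroup.closure {a | ∃ (u w : V) (hu : h u u ≠ 0) (hw : h w w ≠ 0),
    a = h.orthReflection u hu * h.orthReflection w hw}

include hs ha in
-- Induction on the number of basis vectors that may still move. If a moves v p, put u = a (v p) - v
-- p; by anisotropy u is nonsingular, its reflection takes a (v p) back to v p, and it fixes the
-- later basis vectors, which are perpendicular to both. The two alternatives keep track of the
-- parity of the number of reflections.
theorem mem_reflectionPairs_or (v : Basis (Fin 4) F V)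
    (hv : ∀ i j, i ≠ j → h (v i) (v j) = 0) (k : ℕ) : k ≤ 4 → ∀ a : V ≃ₗ[F] V,
    (∀ x y, h (a x) (a y) = h x y) → (∀ i : Fin 4, k ≤ i → a (v i) = v i) →
    a ∈ reflectionPairs h ∨ ∃ (u : V) (hu : h u u ≠ 0),
      h.orthReflection u hu * a ∈ reflectionPairs h := by
  induction k with
  | zero =>
    intro _ a _ hfix
    left
    have : a = 1 := by
      apply LinearEquiv.toLinearMap_injective
      exact v.ext fun i => hfix i (Nat.zero_le _)
    rw [this]
    exact one_mem _
  | succ k ih =>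
    intro hk a hiso hfix
    let p : Fin 4 := ⟨k, by omega⟩
    by_cases hp : a (v p) = v p
    · refine ih (by omega) a hiso fun i hi => ?_
      rcases hi.eq_or_lt with h1 | h1
      · have : i = p := Fin.ext h1.symm
        rw [this, hp]
      · exact hfix i h1
    · let u := a (v p) - v p
      have hu0 : u ≠ 0 := sub_ne_zero.mpr hp
      have hu : h u u ≠ 0 := fun h0 => hu0 (ha u h0)
      have huu : h u u = 2 * h u (a (v p)) := by
        simp only [u, map_sub, LinearMap.sub_apply, hiso]
        rw [show h (v p) (a (v p)) = h (a (v p)) (v p) from hs.eq _ _]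
        ring
      have hup : h.orthReflection u hu (a (v p)) = v p := by
        rw [orthReflection_apply, ← huu, div_self hu]
        simp [u]
      have key := ih (by omega) (h.orthReflection u hu * a)
        (fun x y => (orthReflection_isometry hs u hu _ _).trans (hiso x y)) fun i hi => by
          change h.orthReflection u hu (a (v i)) = v i
          rcases hi.eq_or_lt with h1 | h1
          · have : i = p := Fin.ext h1.symm
            rw [this, hup]
          · rw [hfix i h1]
            apply orthReflection_of_ortho
            have hne : p ≠ i := fun h2 => by simp [← h2, p] at h1
            have h3 : h (a (v p)) (v i) = 0 := by
              have := hiso (v p) (v i)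
              rwa [hfix i h1, hv p i hne] at this
            simp only [u, map_sub, LinearMap.sub_apply, h3, hv p i hne, sub_zero]
      rcases key with h1 | ⟨w, hw, h1⟩
      · exact .inr ⟨u, hu, h1⟩
      -- Two odd steps cancel: with σ denoting reflections, (σ_u σ_w)(σ_w σ_u a) = a.
      · left
        have h2 : h.orthReflection u hu * h.orthReflection w hw ∈ reflectionPairs h :=
          Subgroup.subset_closure ⟨u, w, hu, hw, rfl⟩
        have h3 := mul_mem h2 h1
        rwa [mul_assoc, ← mul_assoc (h.orthReflection w hw), orthReflection_mul_self, one_mul,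
          ← mul_assoc, orthReflection_mul_self, one_mul] at h3

include hs hd in
theorem orthReflection_mul_mem_specialOrthogonal (u w : V) (hu : h u u ≠ 0) (hw : h w w ≠ 0) :
    h.orthReflection u hu * h.orthReflection w hw ∈ specialOrthogonal h := by
  have : FiniteDimensional F V := Module.finite_of_finrank_pos (by omega)
  refine ⟨?_, fun x y => ?_⟩
  · have : ((h.orthReflection u hu * h.orthReflection w hw : V ≃ₗ[F] V) : V →ₗ[F] V) =
      (h.orthReflection u hu : V →ₗ[F] V) * (h.orthReflection w hw : V →ₗ[F] V) := rfl
    rw [this, map_mul, det_orthReflection, det_orthReflection]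
    norm_num
  · exact (orthReflection_isometry hs u hu _ _).trans (orthReflection_isometry hs w hw x y)

include hs ha hd in
/-- The Cartan–Dieudonné theorem for an anisotropic form of dimension four. -/
theorem specialOrthogonal_le_reflectionPairs (h2 : (2 : F) ≠ 0) :
    specialOrthogonal h ≤ reflectionPairs h := by
  have : FiniteDimensional F V := Module.finite_of_finrank_pos (by omega)
  rintro a ⟨hdet, hiso⟩
  obtain ⟨u, hu0, -⟩ := exists_ne_zero_ortho (h := h) hd ![0, 0, 0]
  obtain ⟨w, hw0, hw⟩ := exists_ne_zero_ortho (h := h) hd ![u, u, u]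
  obtain ⟨v, hv, -⟩ := exists_ortho_basis_extending hs ha hd hu0 hw0 (hw 0)
  -- With k = 4 nothing is required to be fixed. The odd alternative is then excluded by the
  -- determinant, as 1 ≠ -1 in F.
  rcases mem_reflectionPairs_or hs ha v hv 4 le_rfl a hiso fun i hi => by omega with h1 | ⟨u, hu, h1⟩
  · exact h1
  · exfalso
    have hle : reflectionPairs h ≤ specialOrthogonal h := by
      rw [reflectionPairs, Subgroup.closure_le]
      rintro _ ⟨u, w, hu, hw, rfl⟩
      exact orthReflection_mul_mem_specialOrthogonal hs hd u w hu hw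
    have h3 : LinearMap.det ((h.orthReflection u hu : V →ₗ[F] V) * (a : V →ₗ[F] V)) = 1 :=
      (hle h1).1
    rw [map_mul, det_orthReflection, hdet] at h3
    exact h2 (by linear_combination -h3)

end Anisotropic

end LinearMap.BilinForm

namespace Hodge.Datum

/-! ## Wedge products and the Hodge structure -/

theorem update_vecCons_zero {V : Type*} (v w x : V) : Function.update ![v, w] 0 x = ![x, w] := by
  ext i; fin_cases i <;> rfl

theorem update_vecCons_one {V : Type*} (v w x : V) : Function.update ![v, w] 1 x = ![v, x] := by
  ext i; fin_cases i <;> rfl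

section

variable {F V : Type*} [Field F] [AddCommGroup V] [Module F V] (D : Datum F V)

/-- The bivector `v ∧ w`, as a bilinear function. -/
noncomputable def wedge : V →ₗ[F] V →ₗ[F] D.W :=
  LinearMap.mk₂ F (fun v w => D.ofW.symm (exteriorPower.ιMulti F 2 ![v, w]))
    (fun v v' w => by
      have := (exteriorPower.ιMulti F 2).map_update_add ![v, w] 0 v v'
      simp only [update_vecCons_zero] at this
      rw [this, map_add])
    (fun c v w => by
      have := (exteriorPower.ιMulti F 2).map_update_smul ![v, w] 0 c v
      simp only [update_vecCons_zero] at this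
      rw [this, map_smul])
    (fun v w w' => by
      have := (exteriorPower.ιMulti F 2).map_update_add ![v, w] 1 w w'
      simp only [update_vecCons_one] at this
      rw [this, map_add])
    (fun c v w => by
      have := (exteriorPower.ιMulti F 2).map_update_smul ![v, w] 1 c w
      simp only [update_vecCons_one] at this
      rw [this, map_smul])

variable {D}

theorem ofW_wedge (v w : V) : D.ofW (D.wedge v w) = exteriorPower.ιMulti F 2 ![v, w] := rfl

theorem wedge_self (v : V) : D.wedge v v = 0 := by
  apply D.ofW.injective
  rw [ofW_wedge, map_zero]
  exact (exteriorPower.ιMulti F 2).map_eq_zero_of_eq ![v, v] (i := 0) (j := 1) rfl (by simp)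

theorem extForm_wedge (v w x y : V) :
    extForm D.h (D.ofW (D.wedge v w)) (D.ofW (D.wedge x y)) = D.h v x * D.h w y - D.h v y * D.h w x :=
  extForm_apply D.h ![v, w] ![x, y]

theorem pfaffian_wedge (v w x y : V) :
    pfaffian D.b (D.ofW (D.wedge v w)) (D.ofW (D.wedge x y)) =
      D.b (exteriorPower.ιMulti F 4 ![v, w, x, y]) :=
  pfaffian_apply D.b ![v, w] ![x, y]

theorem pfaffian_wedge_eq_zero (v w y : V) :
    pfaffian D.b (D.ofW (D.wedge v w)) (D.ofW (D.wedge v y)) = 0 := by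
  rw [pfaffian_wedge, (exteriorPower.ιMulti F 4).map_eq_zero_of_eq ![v, w, v, y] (i := 0) (j := 2)
    rfl (by simp), map_zero]

theorem eta_wedge (a : V ≃ₗ[F] V) (v w : V) : D.eta a (D.wedge v w) = D.wedge (a v) (a w) := by
  apply D.ofW.injective
  rw [ofW_wedge]
  change exteriorPower.map 2 _ (exteriorPower.ιMulti F 2 ![v, w]) = _
  rw [exteriorPower.map_apply_ιMulti]
  congr 1
  ext i; fin_cases i <;> rfl

theorem ofW_eta (a : V ≃ₗ[F] V) (x : D.W) :
    D.ofW (D.eta a x) = exteriorPower.map 2 (a : V →ₗ[F] V) (D.ofW x) := rfl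

theorem extForm_eta {a : V ≃ₗ[F] V} (ha : ∀ u v, D.h (a u) (a v) = D.h u v) (x y : D.W) :
    extForm D.h (D.ofW (D.eta a x)) (D.ofW (D.eta a y)) = extForm D.h (D.ofW x) (D.ofW y) := by
  have key : (extForm D.h).compl₁₂ (exteriorPower.map 2 (a : V →ₗ[F] V))
      (exteriorPower.map 2 (a : V →ₗ[F] V)) = extForm D.h := by
    apply ext_two D.basis
    intro i j _
    apply ext_two D.basis
    intro k l _
    simp [exteriorPower.map_apply_ιMulti, extForm_apply, ha]
  exact congrArg (fun f => f (D.ofW x) (D.ofW y)) key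

theorem pfaffian_eta (a : V ≃ₗ[F] V) (x y : D.W) :
    pfaffian D.b (D.ofW (D.eta a x)) (D.ofW (D.eta a y)) =
      LinearMap.det (a : V →ₗ[F] V) * pfaffian D.b (D.ofW x) (D.ofW y) := by
  have h4 : ∀ v : Fin 4 → V, D.b (exteriorPower.ιMulti F 4 (a ∘ v)) =
      LinearMap.det (a : V →ₗ[F] V) * D.b (exteriorPower.ιMulti F 4 v) := by
    intro v
    have h1 := (D.b.toLinearMap.compAlternatingMap
      (exteriorPower.ιMulti F 4)).eq_smul_basis_det D.basis
    have h2 := congrArg (fun f => f v) h1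
    have h3 := congrArg (fun f => f (a ∘ v)) h1
    simp only [LinearMap.compAlternatingMap_apply, LinearEquiv.coe_coe, AlternatingMap.smul_apply,
      smul_eq_mul] at h2 h3
    have h5 := Basis.det_comp D.basis (a : V →ₗ[F] V) v
    rw [LinearEquiv.coe_coe] at h5
    rw [h3, h2, h5]
    ring
  have key : (pfaffian D.b).compl₁₂ (exteriorPower.map 2 (a : V →ₗ[F] V))
      (exteriorPower.map 2 (a : V →ₗ[F] V)) = LinearMap.det (a : V →ₗ[F] V) • pfaffian D.b := by
    apply ext_two D.basis
    intro i j _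
    apply ext_two D.basis
    intro k l _
    simp only [LinearMap.compl₁₂_apply, exteriorPower.map_apply_ιMulti, pfaffian_apply,
      LinearMap.smul_apply, smul_eq_mul, ← h4]
    rfl
  exact congrArg (fun f => f (D.ofW x) (D.ofW y)) key

theorem eta_add (a : V ≃ₗ[F] V) (x y : D.W) : D.eta a (x + y) = D.eta a x + D.eta a y := by
  apply D.ofW.injective
  simp only [ofW_eta, map_add]

/-- J is determined by Λ²h and Pf. The first is preserved because a is an isometry, the second
because det a = 1, so η a commutes with J and is therefore K-linear. -/
theorem hodge_eta {a : V ≃ₗ[F] V} (ha : a ∈ specialOrthogonal D.h) (x : D.W) :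
    D.hodge (D.ofW (D.eta a x)) = D.ofW (D.eta a (D.ofW.symm (D.hodge (D.ofW x)))) := by
  rw [← sub_eq_zero]
  apply (pfaffian_nondegenerate D.b D.basis).1
  intro y
  obtain ⟨y, rfl⟩ := D.ofW.surjective y
  obtain ⟨y, rfl⟩ := (D.eta a).surjective y
  rw [map_sub, LinearMap.sub_apply, pfaffian_hodge, extForm_eta ha.2, pfaffian_eta, ha.1,
    LinearEquiv.apply_symm_apply, pfaffian_hodge, one_mul, sub_self]

theorem eta_smul {a : V ≃ₗ[F] V} (ha : a ∈ specialOrthogonal D.h) (c : D.K) (x : D.W) :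
    D.eta a (c • x) = c • D.eta a x := by
  apply D.ofW.injective
  rw [ofW_smul, hodge_eta ha]
  simp only [ofW_eta, ofW_smul, map_add, map_smul, LinearEquiv.apply_symm_apply]

/-- `η a` as a `K`-linear map. -/
noncomputable def etaLinear {a : V ≃ₗ[F] V} (ha : a ∈ specialOrthogonal D.h) : D.W →ₗ[D.K] D.W where
  toFun := D.eta a
  map_add' := eta_add a
  map_smul' := eta_smul ha

theorem g_apply (u v : D.W) : D.g u v =
    ⟨extForm D.h (D.ofW u) (D.ofW v), pfaffian D.b (D.ofW u) (D.ofW v)⟩ := rfl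

theorem g_isSymm : D.g.IsSymm := by
  refine ⟨fun u v => ?_⟩
  simp only [g_apply, D.extForm_symm (D.ofW v), D.pfaffian_symm (D.ofW v)]

/-- Bivectors with a common factor have wedge product zero, so the j-component vanishes. This is the
source of all values of g in F. -/
theorem g_wedge (v w y : V) : D.g (D.wedge v w) (D.wedge v y) =
    algebraMap F D.K (D.h v v * D.h w y - D.h v y * D.h w v) := by
  rw [g_apply, pfaffian_wedge_eq_zero, extForm_wedge]
  rfl

/-- A bivector `X` with `Pf X X = 0` is decomposable. -/
theorem exists_wedge_eq (h2 : (2 : F) ≠ 0) {X : D.W} (hX : X ≠ 0)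
    (hP : pfaffian D.b (D.ofW X) (D.ofW X) = 0) : ∃ v w : V, X = D.wedge v w := by
  -- By nondegeneracy some Plücker coordinate of X is nonzero; permuting the basis makes it the one
  -- belonging to v 2 and v 3.
  obtain ⟨v, hv⟩ : ∃ v : Basis (Fin 4) F V,
      pfaffian D.b (D.ofW X) (D.ofW (D.wedge (v 2) (v 3))) ≠ 0 := by
    by_contra hcon
    push Not at hcon
    have h0 : pfaffian D.b (D.ofW X) = 0 := by
      apply ext_two D.basis
      intro i j hij
      obtain ⟨σ, hσ2, hσ3⟩ : ∃ σ : Equiv.Perm (Fin 4), σ.symm 2 = i ∧ σ.symm 3 = j := by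
        revert i j; decide
      have := hcon (D.basis.reindex σ)
      rwa [Basis.reindex_apply, Basis.reindex_apply, hσ2, hσ3] at this
    exact hX (D.ofW.map_eq_zero_iff.mp
      ((pfaffian_nondegenerate D.b D.basis).1 _ fun y => by rw [h0]; rfl))
  let e (i j : Fin 4) : D.W := D.wedge (v i) (v j)
  let P (i j : Fin 4) : F := pfaffian D.b (D.ofW X) (D.ofW (e i j))
  let β : F := D.b (exteriorPower.ιMulti F 4 v)
  have hβ : β ≠ 0 := vol_ne_zero D.b v
  have hexp : β • X = P 2 3 • e 0 1 - P 1 3 • e 0 2 + P 1 2 • e 0 3 + P 0 3 • e 1 2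
      - P 0 2 • e 1 3 + P 0 1 • e 2 3 := D.ofW.injective (expand D.b v (D.ofW X))
  -- The Plücker relation: pairing the expansion of β X with X gives twice its left-hand side.
  have hrel : P 0 1 * P 2 3 - P 0 2 * P 1 3 + P 0 3 * P 1 2 = 0 := by
    have h1 := congrArg (fun z => pfaffian D.b (D.ofW X) (D.ofW z)) hexp
    simp only [map_add, map_sub, map_smul, smul_eq_mul, hP, mul_zero] at h1
    have h3 : (2 : F) * (P 0 1 * P 2 3 - P 0 2 * P 1 3 + P 0 3 * P 1 2) = 0 := by
      rw [h1]
      simp only [P]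
      ring
    exact (mul_eq_zero.mp h3).resolve_left h2
  have hP23 : P 2 3 ≠ 0 := hv
  -- Up to factors, the two vectors are the contractions of X with the coordinate functionals dual
  -- to v 1 and v 0; they span the plane that X represents. The Plücker relation accounts for the
  -- coefficient of e 2 3.
  refine ⟨(β * P 2 3)⁻¹ • (P 2 3 • v 0 - P 0 3 • v 2 + P 0 2 • v 3),
    P 2 3 • v 1 - P 1 3 • v 2 + P 1 2 • v 3, ?_⟩
  have hsw : ∀ i j, D.wedge (v i) (v j) = - D.wedge (v j) (v i) := by
    intro i j
    have := wedge_self (D := D) (v i + v j)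
    simp only [map_add, LinearMap.add_apply, wedge_self, zero_add, add_zero] at this
    exact eq_neg_of_add_eq_zero_right this
  rw [map_smul, LinearMap.smul_apply, eq_inv_smul_iff₀ (mul_ne_zero hβ hP23), mul_comm, mul_smul,
    hexp]
  simp only [map_add, map_sub, map_smul, LinearMap.add_apply, LinearMap.sub_apply,
    LinearMap.smul_apply, wedge_self, hsw 2 1, hsw 3 1, hsw 3 2, e]
  rw [smul_add, smul_smul (P 2 3) (P 0 1), show P 2 3 * P 0 1 = P 0 2 * P 1 3 - P 0 3 * P 1 2 by
    linear_combination hrel]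
  module

/-- A decomposable bivector, written in terms of an orthogonal basis. -/
theorem exists_ortho_basis_wedge_eq (ha : D.IsAnisotropic) {v w : V} (hX : D.wedge v w ≠ 0) :
    ∃ u : Basis (Fin 4) F V, (∀ i j, i ≠ j → D.h (u i) (u j) = 0) ∧
      D.wedge v w = D.wedge (u 0) (u 1) := by
  have hv : v ≠ 0 := by rintro rfl; simp at hX
  have hvv : D.h v v ≠ 0 := fun h0 => hv (ha v h0)
  let w' := w - (D.h v w / D.h v v) • v
  have hw : D.wedge v w = D.wedge v w' := by simp [w', wedge_self]
  have hw' : w' ≠ 0 := by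
    intro h0
    rw [hw, h0, map_zero] at hX
    exact hX rfl
  have ho : D.h v w' = 0 := by simp [w', div_mul_cancel₀ _ hvv]
  obtain ⟨u, hu, h0, h1⟩ :=
    LinearMap.BilinForm.exists_ortho_basis_extending D.symm ha D.finrank_eq hv hw' ho
  exact ⟨u, hu, by rw [hw, h0, h1]⟩

end

end Hodge.Datum

namespace Hodge.Datum

/-! ## Half-turns of the exterior square -/

section

variable {F V : Type*} [Field F] [AddCommGroup V] [Module F V] {D : Datum F V}

/-- A root r of δ would give (r + j)(r - j) = 0. The `Fact`, with its summand `0 * r`, is the form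
in which the field instance on `D.K` expects this. -/
theorem fact_of_not_isSplit (hs : ¬ D.IsSplit) : Fact (∀ r : F, r ^ 2 ≠ D.delta + 0 * r) := by
  refine ⟨fun r hr => hs ⟨⟨r, 1⟩, ⟨r, -1⟩, ?_, ?_, ?_⟩⟩
  · intro h; simpa using congrArg QuadraticAlgebra.im h
  · intro h; simpa using congrArg QuadraticAlgebra.im h
  · ext <;> simp
    linear_combination hr

variable [Fact (∀ r : F, r ^ 2 ≠ D.delta + 0 * r)]

theorem two_ne_zero_K (h2 : (2 : F) ≠ 0) : (2 : D.K) ≠ 0 := by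
  intro h
  apply h2
  apply (algebraMap F D.K).injective
  rw [map_ofNat, h, map_zero]

theorem finrank_W : finrank D.K D.W = 3 := by
  have hV : Module.Finite F V := Module.finite_of_finrank_pos (by rw [D.finrank_eq]; norm_num)
  have h1 : finrank F D.W = 6 := by
    rw [D.ofW.finrank_eq, exteriorPower.finrank_eq, D.finrank_eq]
    rfl
  have h3 := Module.finrank_mul_finrank F D.K D.W
  rw [h1, QuadraticAlgebra.finrank_eq_two] at h3
  omega

/-- These bivectors share the factor v 0, so `g_wedge` shows that they are orthogonal with nonzero
values in F. Over K three of them suffice. -/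
theorem exists_basis_wedge (ha : D.IsAnisotropic) (v : Basis (Fin 4) F V)
    (hv : ∀ i j, i ≠ j → D.h (v i) (v j) = 0) :
    ∃ E : Basis (Fin 3) D.K D.W, ∀ i, E i = D.wedge (v 0) (v i.succ) := by
  have hne : ∀ i, D.h (v i) (v i) ≠ 0 := fun i h0 => v.ne_zero i (ha _ h0)
  have hli : LinearIndependent D.K fun i : Fin 3 => D.wedge (v 0) (v i.succ) := by
    refine LinearMap.BilinForm.linearIndependent_of_iIsOrtho (B := D.g) (fun i j hij => ?_)
      fun i => ?_
    · change D.g _ _ = 0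
      rw [g_wedge, hv i.succ j.succ (by simpa using hij), hv 0 j.succ (Fin.succ_ne_zero j).symm]
      simp
    · rw [g_wedge, hv 0 i.succ (Fin.succ_ne_zero i).symm]
      simp [hne]
  exact ⟨basisOfLinearIndependentOfCardEqFinrank hli (by simp [finrank_W]), by simp⟩

/-- X is a product of two perpendicular nonzero vectors, and g X X is the product of their h-values.
-/
theorem g_self_ne_zero (h2 : (2 : F) ≠ 0) (ha : D.IsAnisotropic) {X : D.W} (hX : X ≠ 0)
    (hP : pfaffian D.b (D.ofW X) (D.ofW X) = 0) : D.g X X ≠ 0 := by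
  obtain ⟨v, w, rfl⟩ := exists_wedge_eq h2 hX hP
  obtain ⟨u, hu, hvw⟩ := exists_ortho_basis_wedge_eq ha hX
  have hne : ∀ i, D.h (u i) (u i) ≠ 0 := fun i h0 => u.ne_zero i (ha _ h0)
  rw [hvw, g_wedge, hu 0 1 (by simp)]
  simp [hne]

/-- Both sides are K-linear, so it suffices to compare them on the K-basis v 0 ∧ v i. The two
reflections negate v 2 and v 3 and fix v 0 and v 1, hence give 1, -1, -1 there, as the half-turn
does. -/
theorem eta_reflection_mul_reflection (ha : D.IsAnisotropic) (v : Basis (Fin 4) F V)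
    (hv : ∀ i j, i ≠ j → D.h (v i) (v j) = 0) (h2' : D.h (v 2) (v 2) ≠ 0)
    (h3' : D.h (v 3) (v 3) ≠ 0) (hX : D.g (D.wedge (v 0) (v 1)) (D.wedge (v 0) (v 1)) ≠ 0)
    (x : D.W) :
    D.eta (D.h.orthReflection (v 2) h2' * D.h.orthReflection (v 3) h3') x =
      D.g.halfTurn (D.wedge (v 0) (v 1)) hX x := by
  obtain ⟨E, hE⟩ := exists_basis_wedge ha v hv
  set a := D.h.orthReflection (v 2) h2' * D.h.orthReflection (v 3) h3' with ha'
  have hmem : a ∈ specialOrthogonal D.h :=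
    LinearMap.BilinForm.orthReflection_mul_mem_specialOrthogonal D.symm D.finrank_eq _ _ h2' h3'
  have hmul : ∀ y, a y = D.h.orthReflection (v 2) h2' (D.h.orthReflection (v 3) h3' y) :=
    fun y => rfl
  have ho : ∀ i, i ≠ 2 → i ≠ 3 → a (v i) = v i := by
    intro i h2 h3
    rw [hmul, D.h.orthReflection_of_ortho _ h3' (hv 3 i h3.symm),
      D.h.orthReflection_of_ortho _ h2' (hv 2 i h2.symm)]
  have ha2 : a (v 2) = - v 2 := by
    rw [hmul, D.h.orthReflection_of_ortho _ h3' (hv 3 2 (by simp)), D.h.orthReflection_self]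
  have ha3 : a (v 3) = - v 3 := by
    rw [hmul, D.h.orthReflection_self, map_neg, D.h.orthReflection_of_ortho _ h2' (hv 2 3 (by simp))]
  have key : etaLinear hmem = (D.g.halfTurn (D.wedge (v 0) (v 1)) hX : D.W →ₗ[D.K] D.W) := by
    apply E.ext
    intro i
    rw [hE]
    change D.eta a _ = D.g.halfTurn (D.wedge (v 0) (v 1)) hX _
    rw [eta_wedge, ho 0 (by simp) (by simp)]
    have hort : ∀ j, j ≠ 1 → j ≠ 0 → D.g (D.wedge (v 0) (v 1)) (D.wedge (v 0) (v j)) = 0 := by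
      intro j h1 h0
      rw [g_wedge, hv 1 j h1.symm, hv 0 j h0.symm]
      simp
    fin_cases i
    · change D.wedge (v 0) (a (v 1)) = D.g.halfTurn _ _ (D.wedge (v 0) (v 1))
      rw [ho 1 (by simp) (by simp), LinearMap.BilinForm.halfTurn_self]
    · change D.wedge (v 0) (a (v 2)) = D.g.halfTurn _ _ (D.wedge (v 0) (v 2))
      rw [ha2, LinearMap.BilinForm.halfTurn_of_ortho _ _ (hort 2 (by simp) (by simp)), map_neg]
    · change D.wedge (v 0) (a (v 3)) = D.g.halfTurn _ _ (D.wedge (v 0) (v 3))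
      rw [ha3, LinearMap.BilinForm.halfTurn_of_ortho _ _ (hort 3 (by simp) (by simp)), map_neg]
  exact congrArg (fun f => f x) key

theorem halfTurn_mem_SOext {X : D.W} (hX : D.g X X ≠ 0) :
    MulAction.toPermHom (D.W ≃ₗ[D.K] D.W) D.W (D.g.halfTurn X hX) ∈ D.SOext :=
  ⟨_, LinearMap.BilinForm.halfTurn_mem_specialOrthogonal g_isSymm finrank_W X hX, rfl⟩

/-- The determinant of η a over K is not computed directly: generators of SO(V, h) are sent to
half-turns or products of two half-turns. -/
theorem etaSO_le_SOext (h2 : (2 : F) ≠ 0) (ha : D.IsAnisotropic) : D.etaSO ≤ D.SOext := by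
  have hne : ∀ u : V, u ≠ 0 → D.h u u ≠ 0 := fun u hu h0 => hu (ha u h0)
  have hortho : ∀ (u w : V) (hu : D.h u u ≠ 0) (hw : D.h w w ≠ 0), D.h u w = 0 →
      D.h.orthReflection u hu * D.h.orthReflection w hw ∈ D.SOext.comap D.eta := by
    intro u w hu hw huw
    have hu0 : u ≠ 0 := by rintro rfl; simp at hu
    have hw0 : w ≠ 0 := by rintro rfl; simp at hw
    obtain ⟨v, hv, h0, h1⟩ :=
      LinearMap.BilinForm.exists_ortho_basis_extending D.symm ha D.finrank_eq hu0 hw0 huw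
    -- The shift by 2 moves u and w from places 0 and 1 to places 2 and 3.
    let σ : Equiv.Perm (Fin 4) := Equiv.addRight 2
    have h2' : v.reindex σ 2 = u := by rw [Basis.reindex_apply, ← h0]; rfl
    have h3' : v.reindex σ 3 = w := by rw [Basis.reindex_apply, ← h1]; rfl
    have hv' : ∀ i j, i ≠ j → D.h (v.reindex σ i) (v.reindex σ j) = 0 := fun i j hij => by
      rw [Basis.reindex_apply, Basis.reindex_apply]
      exact hv _ _ (by simpa using hij)
    have hX : D.g (D.wedge (v.reindex σ 0) (v.reindex σ 1))
        (D.wedge (v.reindex σ 0) (v.reindex σ 1)) ≠ 0 := by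
      rw [g_wedge, hv' 0 1 (by simp)]
      rw [zero_mul, sub_zero, ne_eq, FaithfulSMul.algebraMap_eq_zero_iff]
      exact mul_ne_zero (hne _ ((v.reindex σ).ne_zero 0)) (hne _ ((v.reindex σ).ne_zero 1))
    subst h2' h3'
    have := eta_reflection_mul_reflection ha (v.reindex σ) hv' hu hw hX
    rw [Subgroup.mem_comap]
    convert halfTurn_mem_SOext hX
    ext x
    exact this x
  rw [etaSO, Subgroup.map_le_iff_le_comap]
  refine (LinearMap.BilinForm.specialOrthogonal_le_reflectionPairs D.symm ha D.finrank_eq h2).trans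
    ?_
  rw [LinearMap.BilinForm.reflectionPairs, Subgroup.closure_le]
  rintro _ ⟨u, w, hu, hw, rfl⟩
  -- A vector z perpendicular to u and w splits the pair into two perpendicular pairs: σ_u σ_w =
  -- (σ_u σ_z)(σ_z σ_w).
  obtain ⟨z, hz0, hz⟩ := LinearMap.BilinForm.exists_ne_zero_ortho (h := D.h) D.finrank_eq ![u, w, w]
  have hzz := hne z hz0
  have h := mul_mem (hortho u z hu hzz (hz 0)) (hortho z w hzz hw ((D.symm.eq w z).symm.trans (hz 1)))
  rwa [mul_assoc, ← mul_assoc (D.h.orthReflection z hzz), LinearMap.BilinForm.orthReflection_mul_self,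
    one_mul] at h

/-- The half-turn group is generated by the half-turns about singular bivectors. -/
theorem halfTurnGroup_eq (h2 : (2 : F) ≠ 0) (ha : D.IsAnisotropic) :
    D.halfTurnGroup = Subgroup.closure {f | ∃ (X : D.W) (hX : D.g X X ≠ 0),
      pfaffian D.b (D.ofW X) (D.ofW X) = 0 ∧
        f = MulAction.toPermHom (D.W ≃ₗ[D.K] D.W) D.W (D.g.halfTurn X hX)} := by
  rw [halfTurnGroup, MonoidHom.map_closure]
  congr 1
  ext f
  constructor
  · rintro ⟨t, ⟨A, ht, X, hXA, hX0, hP⟩, rfl⟩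
    have hX := g_self_ne_zero h2 ha hX0 hP
    exact ⟨X, hX, hP, by rw [ht.eq_halfTurn finrank_W hXA hX]⟩
  · rintro ⟨X, hX, hP, rfl⟩
    refine ⟨_, ⟨D.K ∙ X, LinearMap.BilinForm.isHalfTurn_halfTurn (two_ne_zero_K h2) g_isSymm
      finrank_W X hX, X, Submodule.mem_span_singleton_self X, ?_, hP⟩, rfl⟩
    rintro rfl
    simp at hX

theorem halfTurnGroup_le_etaSO (h2 : (2 : F) ≠ 0) (ha : D.IsAnisotropic) :
    D.halfTurnGroup ≤ D.etaSO := by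
  rw [halfTurnGroup_eq h2 ha, Subgroup.closure_le]
  rintro _ ⟨X, hX, hP, rfl⟩
  have hX0 : X ≠ 0 := by rintro rfl; simp at hX
  obtain ⟨v, w, rfl⟩ := exists_wedge_eq h2 hX0 hP
  obtain ⟨u, hu, hvw⟩ := exists_ortho_basis_wedge_eq ha hX0
  have hne : ∀ i, D.h (u i) (u i) ≠ 0 := fun i h0 => u.ne_zero i (ha _ h0)
  simp only [hvw] at hX ⊢
  refine ⟨D.h.orthReflection (u 2) (hne 2) * D.h.orthReflection (u 3) (hne 3),
    LinearMap.BilinForm.orthReflection_mul_mem_specialOrthogonal D.symm D.finrank_eq _ _ _ _, ?_⟩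
  ext x
  exact eta_reflection_mul_reflection ha u hu (hne 2) (hne 3) hX x

omit [Fact (∀ r : F, r ^ 2 ≠ D.delta + 0 * r)] in
theorem SOext_le_gammaOext : D.SOext ≤ D.gammaOext := by
  rintro _ ⟨t, ht, rfl⟩
  refine ⟨map_add t, RingEquiv.refl _, RingEquiv.refl _, 1, fun _ => rfl, map_smul t, fun u v => ?_⟩
  rw [Units.val_one, one_mul]
  exact ht.2 u v

/-- The conjugate is the half-turn about f X. Here g X X lies in F, and so does c²r for a suitable c
≠ 0; hence g takes a value in F at c • f X, which generates the same axis and lies on the Klein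
quadric. -/
theorem conj_mem_halfTurnGroup (h2 : (2 : F) ≠ 0) (ha : D.IsAnisotropic) {f n : Equiv.Perm D.W}
    (hf : f ∈ D.gammaOext) (hn : n ∈ D.halfTurnGroup) : f * n * f⁻¹ ∈ D.halfTurnGroup := by
  suffices h : D.halfTurnGroup ≤ D.halfTurnGroup.comap (MulAut.conj f).toMonoidHom from h hn
  conv_lhs => rw [halfTurnGroup_eq h2 ha]
  rw [Subgroup.closure_le]
  rintro _ ⟨X, hX, hP, rfl⟩
  change f * _ * f⁻¹ ∈ D.halfTurnGroup
  obtain ⟨hadd, φ, ψ, r, hφ, hsmul, hsim⟩ := hf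
  have hr := r.ne_zero
  obtain ⟨z, w, hzw⟩ := exists_wedge_eq h2 (by rintro rfl; simp at hX) hP
  -- Any orthogonal basis of V would do: it only provides a Gram determinant of g that is a nonzero
  -- element of F.
  obtain ⟨v, hv, -⟩ := exists_ortho_basis_wedge_eq ha (v := z) (w := w)
    (by rw [← hzw]; rintro rfl; simp at hX)
  obtain ⟨E, hE⟩ := exists_basis_wedge ha v hv
  have hne : ∀ i, D.h (v i) (v i) ≠ 0 := fun i h0 => v.ne_zero i (ha _ h0)
  obtain ⟨d, hd0, hd⟩ : ∃ d : F, d ≠ 0 ∧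
      (Matrix.of fun i j => D.g (E i) (E j)).det = algebraMap F D.K d := by
    refine ⟨∏ i : Fin 3, D.h (v 0) (v 0) * D.h (v i.succ) (v i.succ),
      Finset.prod_ne_zero_iff.mpr fun i _ => mul_ne_zero (hne _) (hne _), ?_⟩
    have : (Matrix.of fun i j => D.g (E i) (E j)) = Matrix.diagonal fun i : Fin 3 =>
        algebraMap F D.K (D.h (v 0) (v 0) * D.h (v i.succ) (v i.succ)) := by
      ext1 i j
      rw [Matrix.of_apply, hE, hE, g_wedge, hv 0 j.succ (Fin.succ_ne_zero j).symm, zero_mul, sub_zero]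
      by_cases hij : i = j
      · rw [hij, Matrix.diagonal_apply_eq]
      · rw [hv i.succ j.succ (by simpa using hij), mul_zero, map_zero, Matrix.diagonal_apply_ne _ hij]
    rw [this, Matrix.det_diagonal, map_prod]
  have hdK : algebraMap F D.K d ≠ 0 := by simpa using hd0
  obtain ⟨c, hc0, hc⟩ :=
    LinearMap.BilinForm.exists_sq_mul_multiplier_mem E d hd hdK hφ hsim
  have hfX : D.g (f X) (f X) ≠ 0 := by
    rw [hsim]
    exact mul_ne_zero hr (by simpa using hX)
  have hcX : D.g (c • f X) (c • f X) ≠ 0 := by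
    simpa [hc0] using hfX
  rw [halfTurnGroup_eq h2 ha]
  refine Subgroup.subset_closure ⟨c • f X, hcX, ?_, ?_⟩
  · have hXF : D.g X X = algebraMap F D.K (extForm D.h (D.ofW X) (D.ofW X)) := by
      rw [g_apply, hP]
      rfl
    have hcF : D.g (c • f X) (c • f X) =
        algebraMap F D.K (ψ d / d * ψ (extForm D.h (D.ofW X) (D.ofW X))) := by
      simp only [map_smul, LinearMap.smul_apply, smul_eq_mul, hsim]
      rw [hXF, hφ, map_mul, map_div₀, ← hc]
      field_simp
    exact congrArg QuadraticAlgebra.im hcF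
  · rw [LinearMap.BilinForm.halfTurn_smul (f X) hfX c hcX]
    ext y
    exact LinearMap.BilinForm.semiSimilitude_conj_halfTurn hadd hsmul hsim X hX hfX y

end

end Hodge.Datum

namespace Hodge.Datum

/-! ## Half-turns outside the image of `η` -/

section

variable {F V : Type*} [Field F] [AddCommGroup V] [Module F V] {D : Datum F V}

/-- The kernel of `η` consists of scalars of square one. -/
theorem exists_eq_smul_of_eta_eq_one (ha : D.IsAnisotropic) (v : Basis (Fin 4) F V)
    (hv : ∀ i j, i ≠ j → D.h (v i) (v j) = 0) {A : V ≃ₗ[F] V} (hA : D.eta A = 1) :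
    ∃ ε : F, ε * ε = 1 ∧ ∀ x, A x = ε • x := by
  have hne : ∀ i, D.h (v i) (v i) ≠ 0 := fun i h0 => v.ne_zero i (ha _ h0)
  -- The matrix of h (A ·) (·) has the same 2 × 2 minors as that of h.
  have hminor : ∀ x y z w : V, D.h (A x) z * D.h (A y) w - D.h (A x) w * D.h (A y) z =
      D.h x z * D.h y w - D.h x w * D.h y z := by
    intro x y z w
    rw [← extForm_wedge, ← extForm_wedge, ← eta_wedge, hA]
    rfl
  have hdiag : ∀ i k, i ≠ k → D.h (A (v i)) (v k) = 0 := by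
    intro i k hik
    obtain ⟨j, hij, hjk⟩ : ∃ j : Fin 4, i ≠ j ∧ j ≠ k := by
      revert i k; decide
    have h1 := hminor (v i) (v j) (v i) (v j)
    have h2 := hminor (v i) (v j) (v i) (v k)
    have h3 := hminor (v i) (v j) (v j) (v k)
    rw [hv i j hij, zero_mul, sub_zero] at h1
    rw [hv i k hik, hv j k hjk, zero_mul, mul_zero, sub_zero] at h2
    rw [hv i j hij, hv i k hik, zero_mul, zero_mul, sub_zero] at h3
    refine (mul_eq_zero.mp ?_).resolve_right (mul_ne_zero (hne i) (hne j))
    rw [← h1]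
    -- In columns i, j, k, a 3 × 3 determinant with rows i, i, j vanishes; this is its expansion
    -- along a repeated row.
    linear_combination D.h (A (v i)) (v j) * h2 - D.h (A (v i)) (v i) * h3
  have heig : ∀ i, A (v i) = (D.h (A (v i)) (v i) / D.h (v i) (v i)) • v i := by
    intro i
    rw [← sub_eq_zero]
    apply ha
    have : D.h (A (v i) - (D.h (A (v i)) (v i) / D.h (v i) (v i)) • v i) = 0 := by
      apply v.ext
      intro k
      rw [map_sub, map_smul, LinearMap.sub_apply, LinearMap.smul_apply, LinearMap.zero_apply,
        smul_eq_mul]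
      by_cases hik : i = k
      · subst hik
        rw [div_mul_cancel₀ _ (hne i), sub_self]
      · rw [hdiag i k hik, hv i k hik, mul_zero, sub_zero]
    rw [this, LinearMap.zero_apply]
  set l : Fin 4 → F := fun i => D.h (A (v i)) (v i) / D.h (v i) (v i) with hl
  have hll : ∀ i j, i ≠ j → l i * l j = 1 := by
    intro i j hij
    have h1 := hminor (v i) (v j) (v i) (v j)
    rw [hdiag i j hij, hv i j hij, zero_mul, zero_mul, sub_zero, sub_zero] at h1
    simp only [hl]
    rw [div_mul_div_comm, h1, div_self (mul_ne_zero (hne i) (hne j))]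
  -- l i and l j are both inverse to l k, so a third index makes them equal.
  have hcancel : ∀ i j k, i ≠ k → j ≠ k → l i = l j := by
    intro i j k hik hjk
    have h0 : l k ≠ 0 := right_ne_zero_of_mul_eq_one (hll i k hik)
    exact mul_right_cancel₀ h0 ((hll i k hik).trans (hll j k hjk).symm)
  have hall : ∀ i, l i = l 0 := by
    intro i
    obtain ⟨k, h1, h2⟩ : ∃ k : Fin 4, i ≠ k ∧ 0 ≠ k := by revert i; decide
    exact hcancel i 0 k h1 h2
  refine ⟨l 0, ?_, fun x => ?_⟩
  · have := hll 0 1 (by simp)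
    rwa [hall 1] at this
  · have : (A : V →ₗ[F] V) = l 0 • LinearMap.id := by
      apply v.ext
      intro i
      rw [LinearMap.smul_apply, LinearMap.id_apply, ← hall i]
      exact heig i
    exact congrArg (fun f => f x) this

/-- An isometry `a` with `a² = -1` forces `δ` to be a square. -/
theorem exists_sq_eq_delta (h2 : (2 : F) ≠ 0) (ha : D.IsAnisotropic) {a : V ≃ₗ[F] V}
    (hiso : ∀ x y, D.h (a x) (a y) = D.h x y) (haa : ∀ x, a (a x) = -x) :
    ∃ r : F, r ^ 2 = D.delta := by
  have hself : ∀ x, D.h x (a x) = 0 := by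
    intro x
    have h1 := hiso x (a x)
    rw [haa, map_neg, show D.h (a x) x = D.h x (a x) from D.symm.eq _ _] at h1
    exact (mul_eq_zero.mp (by linear_combination -h1 : (2 : F) * D.h x (a x) = 0)).resolve_left h2
  have hmove : ∀ x y, D.h x (a y) = - D.h (a x) y := by
    intro x y
    rw [← hiso x, haa, map_neg]
  obtain ⟨x, hx0, -⟩ := LinearMap.BilinForm.exists_ne_zero_ortho (h := D.h) D.finrank_eq ![0, 0, 0]
  obtain ⟨y, hy0, hy⟩ :=
    LinearMap.BilinForm.exists_ne_zero_ortho (h := D.h) D.finrank_eq ![x, a x, x]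
  have hxy : D.h x y = 0 := hy 0
  have haxy : D.h (a x) y = 0 := hy 1
  obtain ⟨v, hv, hv'⟩ := LinearMap.BilinForm.exists_basis_of_ortho D.symm ha D.finrank_eq
    hx0 (a.map_ne_zero_iff.mpr hx0) hy0 (a.map_ne_zero_iff.mpr hy0) (hself x) hxy haxy
    (by rw [hmove, haxy, neg_zero]) (by rw [hiso, hxy]) (hself y)
  -- In the orthogonal basis x, a x, y, a y the Gram determinant is (h x x · h y y)².
  refine ⟨D.h x x * D.h y y / D.b (exteriorPower.ιMulti F 4 v), ?_⟩
  have hgram : (Matrix.of fun p q => D.h (v p) (v q)) = Matrix.diagonal fun p => D.h (v p) (v p) := by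
    ext1 p q
    by_cases hpq : p = q
    · rw [hpq, Matrix.of_apply, Matrix.diagonal_apply_eq]
    · rw [Matrix.of_apply, hv p q hpq, Matrix.diagonal_apply_ne _ hpq]
  rw [D.delta_eq v, hgram, Matrix.det_diagonal, Fin.prod_univ_four, div_pow, hv']
  simp only [Matrix.cons_val, hiso]
  ring

/-- An isometric involution has eigenvectors perpendicular to any given three eigenvectors. -/
theorem exists_eigenvector_ortho {a : V ≃ₗ[F] V}
    (hiso : ∀ x y, D.h (a x) (a y) = D.h x y) (haa : ∀ x, a (a x) = x) (s : Fin 3 → V)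
    (hs : ∀ i, a (s i) = s i ∨ a (s i) = -s i) :
    ∃ z, z ≠ 0 ∧ (∀ i, D.h (s i) z = 0) ∧ (a z = z ∨ a z = -z) := by
  obtain ⟨z, hz0, hz⟩ := LinearMap.BilinForm.exists_ne_zero_ortho (h := D.h) D.finrank_eq s
  by_cases h0 : z + a z = 0
  · exact ⟨z, hz0, hz, .inr (eq_neg_of_add_eq_zero_right h0)⟩
  -- The sum z + a z is fixed, and it stays perpendicular to each s i because a z does.
  · refine ⟨z + a z, h0, fun i => ?_, .inl (by rw [map_add, haa, add_comm])⟩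
    have h1 := hiso (s i) (a z)
    rw [haa] at h1
    rw [map_add, hz i, ← h1, zero_add]
    rcases hs i with h | h <;> simp [h, hz i]

/-- An isometric involution fixes some nonzero decomposable bivector. -/
theorem exists_fixed_wedge (ha : D.IsAnisotropic) {a : V ≃ₗ[F] V}
    (hiso : ∀ x y, D.h (a x) (a y) = D.h x y) (haa : ∀ x, a (a x) = x) :
    ∃ p q : V, D.wedge p q ≠ 0 ∧ D.eta a (D.wedge p q) = D.wedge p q := by
  have key : ∀ p q : V, p ≠ 0 → q ≠ 0 → D.h p q = 0 → (a p = p ∧ a q = q ∨ a p = -p ∧ a q = -q) →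
      ∃ p q : V, D.wedge p q ≠ 0 ∧ D.eta a (D.wedge p q) = D.wedge p q := by
    intro p q hp hq hpq h
    refine ⟨p, q, fun h0 => ?_, ?_⟩
    · have h1 := extForm_wedge (D := D) p q p q
      rw [h0, map_zero, map_zero, hpq, zero_mul, sub_zero] at h1
      rcases mul_eq_zero.mp h1.symm with h2 | h2
      · exact hp (ha p h2)
      · exact hq (ha q h2)
    · rw [eta_wedge]
      rcases h with ⟨h1, h2⟩ | ⟨h1, h2⟩ <;> simp [h1, h2]
  obtain ⟨x, hx0, -, hx⟩ := exists_eigenvector_ortho hiso haa ![0, 0, 0]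
    (fun i => by fin_cases i <;> simp)
  obtain ⟨y, hy0, hy, hy'⟩ := exists_eigenvector_ortho hiso haa ![x, x, x]
    (fun i => by fin_cases i <;> exact hx)
  obtain ⟨z, hz0, hz, hz'⟩ := exists_eigenvector_ortho hiso haa ![x, y, y]
    (fun i => by fin_cases i; exacts [hx, hy', hy'])
  have hxy := key x y hx0 hy0 (hy 0)
  have hxz := key x z hx0 hz0 (hz 0)
  have hyz := key y z hy0 hz0 (hz 1)
  -- Among three eigenvalues ±1 two agree, and their product is then 1.
  rcases hx with hx | hx <;> rcases hy' with hy' | hy' <;> rcases hz' with hz' | hz' <;>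
  first
  | exact hxy (.inl ⟨hx, hy'⟩)
  | exact hxy (.inr ⟨hx, hy'⟩)
  | exact hxz (.inl ⟨hx, hz'⟩)
  | exact hxz (.inr ⟨hx, hz'⟩)
  | exact hyz (.inl ⟨hy', hz'⟩)
  | exact hyz (.inr ⟨hy', hz'⟩)

variable [Fact (∀ r : F, r ^ 2 ≠ D.delta + 0 * r)]

/-- A half-turn in the image of `SO(V, h)` has an axis that meets the Klein quadric. -/
theorem exists_pfaffian_eq_zero_of_halfTurn_mem_etaSO (h2 : (2 : F) ≠ 0) (ha : D.IsAnisotropic)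
    {X : D.W} (hX : D.g X X ≠ 0)
    (hmem : MulAction.toPermHom (D.W ≃ₗ[D.K] D.W) D.W (D.g.halfTurn X hX) ∈ D.etaSO) :
    ∃ c : D.K, c ≠ 0 ∧ (c ^ 2 * D.g X X).im = 0 := by
  obtain ⟨a, ⟨-, hiso⟩, hat⟩ := hmem
  have hat' : ∀ x, D.eta a x = D.g.halfTurn X hX x := fun x => congrArg (fun f => f x) hat
  obtain ⟨u, hu0, -⟩ := LinearMap.BilinForm.exists_ne_zero_ortho (h := D.h) D.finrank_eq ![0, 0, 0]
  obtain ⟨w, hw0, hw⟩ := LinearMap.BilinForm.exists_ne_zero_ortho (h := D.h) D.finrank_eq ![u, u, u]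
  obtain ⟨v, hv, -⟩ :=
    LinearMap.BilinForm.exists_ortho_basis_extending D.symm ha D.finrank_eq hu0 hw0 (hw 0)
  -- The half-turn squares to 1, so a² lies in the kernel of η and equals ±1.
  have hone : D.eta (a * a) = 1 := by
    rw [map_mul, hat, ← map_mul, LinearMap.BilinForm.halfTurn_mul_self, map_one]
  obtain ⟨ε, hε, hε'⟩ := exists_eq_smul_of_eta_eq_one ha v hv hone
  have hε'' : ∀ x, a (a x) = ε • x := hε'
  rcases mul_self_eq_one_iff.mp hε with rfl | rfl
  · obtain ⟨p, q, hpq0, hpq⟩ := exists_fixed_wedge ha hiso fun x => by rw [hε'', one_smul]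
    rw [hat', LinearMap.BilinForm.halfTurn_eq_self_iff (two_ne_zero_K h2)] at hpq
    obtain ⟨c, hc⟩ := Submodule.mem_span_singleton.mp hpq
    refine ⟨c, ?_, ?_⟩
    · rintro rfl
      rw [zero_smul] at hc
      exact hpq0 hc.symm
    · have h1 : c ^ 2 * D.g X X = D.g (D.wedge p q) (D.wedge p q) := by
        rw [← hc]
        simp only [map_smul, LinearMap.smul_apply, smul_eq_mul]
        ring
      rw [h1, g_wedge]
      rfl
  · exfalso
    obtain ⟨r, hr⟩ := exists_sq_eq_delta h2 ha hiso fun x => by rw [hε'', neg_one_smul]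
    exact Fact.out (p := ∀ r : F, r ^ 2 ≠ D.delta + 0 * r) r (by rw [hr, zero_mul, add_zero])

end

end Hodge.Datum

namespace Hodge

/-! ## The example over the rational numbers -/

/-- Descent at 5: neither -2 nor 2 is a square modulo 5. The equation modulo 5 makes a and b
divisible by 5; after division by 5 it does the same for c and d, and a second division restores its
original shape. -/
theorem int_five_pow_dvd (n : ℕ) : ∀ a b c d : ℤ,
    a ^ 2 + 2 * b ^ 2 + 10 * c ^ 2 - 5 * d ^ 2 = 0 →
      5 ^ n ∣ a ∧ 5 ^ n ∣ b ∧ 5 ^ n ∣ c ∧ 5 ^ n ∣ d := by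
  have hmod : ∀ x y : ZMod 5, x ^ 2 + 2 * y ^ 2 = 0 → x = 0 ∧ y = 0 := by decide
  have hmod' : ∀ x y : ZMod 5, 2 * x ^ 2 - y ^ 2 = 0 → x = 0 ∧ y = 0 := by decide
  have h5 : (5 : ZMod 5) = 0 := rfl
  have h10 : (10 : ZMod 5) = 0 := rfl
  induction n with
  | zero => intros; simp
  | succ n ih =>
    intro a b c d h
    have h1 := congrArg (Int.cast : ℤ → ZMod 5) h
    push_cast at h1
    rw [h5, h10, zero_mul, zero_mul, add_zero, sub_zero] at h1
    obtain ⟨ha, hb⟩ := hmod _ _ h1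
    obtain ⟨a, rfl⟩ := (ZMod.intCast_zmod_eq_zero_iff_dvd a 5).mp ha
    obtain ⟨b, rfl⟩ := (ZMod.intCast_zmod_eq_zero_iff_dvd b 5).mp hb
    have h' : 5 * a ^ 2 + 10 * b ^ 2 + 2 * c ^ 2 - d ^ 2 = 0 := by
      push_cast at h
      linarith
    have h2 := congrArg (Int.cast : ℤ → ZMod 5) h'
    push_cast at h2
    rw [h5, h10, zero_mul, zero_mul, zero_add, zero_add] at h2
    obtain ⟨hc, hd⟩ := hmod' _ _ h2
    obtain ⟨c, rfl⟩ := (ZMod.intCast_zmod_eq_zero_iff_dvd c 5).mp hc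
    obtain ⟨d, rfl⟩ := (ZMod.intCast_zmod_eq_zero_iff_dvd d 5).mp hd
    obtain ⟨h3, h4, h5, h6⟩ := ih a b c d (by push_cast at h'; linarith)
    rw [pow_succ']
    exact ⟨mul_dvd_mul_left 5 h3, mul_dvd_mul_left 5 h4, mul_dvd_mul_left 5 h5,
      mul_dvd_mul_left 5 h6⟩

theorem int_anisotropic {a b c d : ℤ} (h : a ^ 2 + 2 * b ^ 2 + 10 * c ^ 2 - 5 * d ^ 2 = 0) :
    a = 0 ∧ b = 0 ∧ c = 0 ∧ d = 0 := by
  have key : ∀ x : ℤ, (∀ n : ℕ, 5 ^ n ∣ x) → x = 0 := by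
    intro x hx
    apply Int.eq_zero_of_abs_lt_dvd (hx x.natAbs)
    rw [Int.abs_eq_natAbs]
    exact_mod_cast Nat.lt_pow_self (by norm_num : 1 < 5)
  exact ⟨key a fun n => (int_five_pow_dvd n _ _ _ _ h).1,
    key b fun n => (int_five_pow_dvd n _ _ _ _ h).2.1,
    key c fun n => (int_five_pow_dvd n _ _ _ _ h).2.2.1,
    key d fun n => (int_five_pow_dvd n _ _ _ _ h).2.2.2⟩

theorem exampleForm_apply (x y : Fin 4 → ℚ) : exampleForm x y =
    x 0 * y 0 + 2 * (x 1 * y 1) + 10 * (x 2 * y 2) - 5 * (x 3 * y 3) := by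
  simp only [exampleForm, Matrix.toBilin'_apply', Matrix.mulVec_diagonal, dotProduct,
    Fin.sum_univ_four, Matrix.cons_val]
  ring

theorem exampleForm_anisotropic (x : Fin 4 → ℚ) (hx : exampleForm x x = 0) : x = 0 := by
  rw [exampleForm_apply] at hx
  obtain ⟨m, hm⟩ := IsLocalization.exist_integer_multiples_of_finset (nonZeroDivisors ℤ)
    (Finset.univ.image x)
  have hm0 : ((m : ℤ) : ℚ) ≠ 0 := by exact_mod_cast nonZeroDivisors.ne_zero m.2
  have hint : ∀ i, ∃ k : ℤ, (k : ℚ) = (m : ℤ) * x i := by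
    intro i
    obtain ⟨k, hk⟩ := hm (x i) (Finset.mem_image_of_mem x (Finset.mem_univ i))
    exact ⟨k, by simpa [Submonoid.smul_def] using hk⟩
  choose k hk using hint
  have h : k 0 ^ 2 + 2 * k 1 ^ 2 + 10 * k 2 ^ 2 - 5 * k 3 ^ 2 = 0 := by
    have : ((k 0 : ℚ)) ^ 2 + 2 * k 1 ^ 2 + 10 * k 2 ^ 2 - 5 * k 3 ^ 2 = 0 := by
      simp only [hk]
      linear_combination ((m : ℤ) : ℚ) ^ 2 * hx
    exact_mod_cast this
  obtain ⟨h0, h1, h2, h3⟩ := int_anisotropic h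
  have key : ∀ i, k i = 0 → x i = 0 := by
    intro i hi
    have := hk i
    rw [hi, Int.cast_zero] at this
    exact (mul_eq_zero.mp this.symm).resolve_left hm0
  ext i
  fin_cases i
  · exact key 0 h0
  · exact key 1 h1
  · exact key 2 h2
  · exact key 3 h3

theorem exists_datum_exampleForm : ∃ D : Datum ℚ (Fin 4 → ℚ), D.h = exampleForm := by
  have hd : finrank ℚ (⋀[ℚ]^4 (Fin 4 → ℚ)) = finrank ℚ ℚ := by
    rw [exteriorPower.finrank_eq, finrank_fin_fun, finrank_self]
    rfl
  refine ⟨⟨exampleForm, LinearEquiv.ofFinrankEq _ _ hd, ⟨fun x y => ?_⟩, finrank_fin_fun ℚ⟩, rfl⟩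
  simp only [exampleForm_apply]
  ring

/-! ### Discriminant and an exceptional axis of the example -/

namespace Datum

variable {D : Datum ℚ (Fin 4 → ℚ)}

theorem delta_exampleForm (hD : D.h = exampleForm) :
    D.delta = -100 / D.b (exteriorPower.ιMulti ℚ 4 (Pi.basisFun ℚ (Fin 4))) ^ 2 := by
  rw [D.delta_eq (Pi.basisFun ℚ (Fin 4)), hD]
  congr 1
  have : (Matrix.of fun p q => exampleForm (Pi.basisFun ℚ (Fin 4) p) (Pi.basisFun ℚ (Fin 4) q)) =
      Matrix.diagonal ![1, 2, 10, -5] := by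
    ext p q
    rw [Matrix.of_apply, exampleForm_apply]
    fin_cases p <;> fin_cases q <;> simp [Matrix.diagonal]
  rw [this, Matrix.det_diagonal, Fin.prod_univ_four]
  simp only [Matrix.cons_val]
  norm_num

theorem delta_neg_exampleForm (hD : D.h = exampleForm) : D.delta < 0 := by
  rw [delta_exampleForm hD]
  have := vol_ne_zero D.b (Pi.basisFun ℚ (Fin 4))
  exact div_neg_of_neg_of_pos (by norm_num) (by positivity)

theorem not_isSplit_exampleForm (hD : D.h = exampleForm) : ¬ D.IsSplit := by
  have hδ := delta_neg_exampleForm hD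
  have : Fact (∀ r : ℚ, r ^ 2 ≠ D.delta + 0 * r) :=
    ⟨fun r hr => by rw [zero_mul, add_zero] at hr; nlinarith [sq_nonneg r]⟩
  rintro ⟨x, y, hx, hy, hxy⟩
  exact (mul_eq_zero.mp hxy).elim hx hy

/-- If c²g(X,X) lies in ℚ, its norm is a square, so N(g(X,X)) is a square as well. It suffices to
find X for which this norm is a nonsquare. -/
theorem exists_axis_exampleForm (hD : D.h = exampleForm) :
    ∃ X : D.W, D.g X X ≠ 0 ∧ ∀ c : D.K, c ≠ 0 → (c ^ 2 * D.g X X).im ≠ 0 := by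
  have := fact_of_not_isSplit (not_isSplit_exampleForm hD)
  set β := D.b (exteriorPower.ιMulti ℚ 4 (Pi.basisFun ℚ (Fin 4)))
  have hβ0 : β ≠ 0 := vol_ne_zero D.b _
  have hδ : D.delta = -100 / β ^ 2 := delta_exampleForm hD
  let e : Fin 4 → Fin 4 → ℚ := Pi.basisFun ℚ (Fin 4)
  -- As δ = -100/β², the element i = (β/10) j satisfies i² = -1, and k = 1 + i. Thus g X X = 2 - 5(1
  -- + i)² = 2 - 10 i has norm 104 = 4 · 26.
  let k : D.K := ⟨1, β / 10⟩
  let X : D.W := D.wedge (e 0) (e 1) + k • D.wedge (e 0) (e 3)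
  have hX : D.g X X = ⟨2, -β⟩ := by
    have hg : ∀ v w y, D.g (D.wedge v w) (D.wedge v y) = ⟨D.h v v * D.h w y - D.h v y * D.h w v, 0⟩ :=
      fun v w y => g_wedge v w y
    have h11 : D.g (D.wedge (e 0) (e 1)) (D.wedge (e 0) (e 1)) = ⟨2, 0⟩ := by
      rw [hg, hD]
      ext <;> simp [exampleForm_apply, e]
    have h13 : D.g (D.wedge (e 0) (e 1)) (D.wedge (e 0) (e 3)) = 0 := by
      rw [hg, hD]
      ext <;> simp [exampleForm_apply, e]
    have h31 : D.g (D.wedge (e 0) (e 3)) (D.wedge (e 0) (e 1)) = 0 := by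
      rw [hg, hD]
      ext <;> simp [exampleForm_apply, e]
    have h33 : D.g (D.wedge (e 0) (e 3)) (D.wedge (e 0) (e 3)) = ⟨-5, 0⟩ := by
      rw [hg, hD]
      ext <;> simp [exampleForm_apply, e]
    simp only [X, map_add, map_smul, LinearMap.add_apply, LinearMap.smul_apply, smul_eq_mul, h11,
      h13, h31, h33, mul_zero, add_zero, zero_add]
    ext
    · simp [k, hδ]
      field_simp
      ring
    · simp [k]
      ring
  refine ⟨X, fun h0 => ?_, fun c hc him => ?_⟩
  · rw [hX] at h0
    simpa using congrArg QuadraticAlgebra.re h0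
  · have hsq : QuadraticAlgebra.norm c ^ 2 * 104 = (c ^ 2 * D.g X X).re ^ 2 := by
      have h1 : QuadraticAlgebra.norm (c ^ 2 * D.g X X) = (c ^ 2 * D.g X X).re ^ 2 := by
        rw [QuadraticAlgebra.norm_def, him]
        ring
      have h2 : QuadraticAlgebra.norm (D.g X X) = 104 := by
        rw [hX, QuadraticAlgebra.norm_def, hδ]
        simp
        field_simp
        norm_num
      rw [← h1, map_mul, map_pow, h2]
    have hn : QuadraticAlgebra.norm c ≠ 0 := by
      rwa [ne_eq, QuadraticAlgebra.norm_eq_zero_iff_eq_zero]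
    have h104 : IsSquare (104 : ℚ) := by
      refine ⟨(c ^ 2 * D.g X X).re / QuadraticAlgebra.norm c, ?_⟩
      field_simp
      linear_combination hsq
    revert h104
    decide +kernel

end Datum

end Hodge

/-- Let `char F ≠ 2`. If `h` is anisotropic and `K` is not split then `H` is a normal subgroup of
`ΓO(Λ²V, g)` and `H ≤ η(SO(V, h)) ≤ SO(Λ²V, g)`. For `h = ⟨1, 2, 10, -5⟩` over `ℚ` (and every choice
of `b`) these hypotheses are satisfied, and both `H` and `η(SO(V, h))` are proper subgroups of
`SO(Λ²V, g)`. -/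
theorem mainTheorem10 :
    (∀ {F V : Type*} [Field F] [AddCommGroup V] [Module F V] (D : Hodge.Datum F V),
      (2 : F) ≠ 0 → D.IsAnisotropic → ¬ D.IsSplit →
        (D.halfTurnGroup ≤ D.gammaOext ∧ (D.halfTurnGroup.subgroupOf D.gammaOext).Normal) ∧
        D.halfTurnGroup ≤ D.SOext ∧
        D.halfTurnGroup ≤ D.etaSO ∧ D.etaSO ≤ D.SOext) ∧
    ((∃ D : Hodge.Datum ℚ (Fin 4 → ℚ), D.h = Hodge.exampleForm) ∧
      ∀ D : Hodge.Datum ℚ (Fin 4 → ℚ), D.h = Hodge.exampleForm →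
        D.IsAnisotropic ∧ ¬ D.IsSplit ∧ D.halfTurnGroup < D.SOext ∧ D.etaSO < D.SOext) := by
  refine ⟨fun D h2 ha hs => ?_, Hodge.exists_datum_exampleForm, fun D hD => ?_⟩
  · have := Hodge.Datum.fact_of_not_isSplit hs
    have h1 := Hodge.Datum.halfTurnGroup_le_etaSO h2 ha
    have h3 := Hodge.Datum.etaSO_le_SOext h2 ha
    refine ⟨⟨(h1.trans h3).trans Hodge.Datum.SOext_le_gammaOext, ⟨fun n hn f => ?_⟩⟩,
      h1.trans h3, h1, h3⟩
    exact Hodge.Datum.conj_mem_halfTurnGroup h2 ha f.2 hn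
  · have ha : D.IsAnisotropic := fun v hv => Hodge.exampleForm_anisotropic v (hD ▸ hv)
    have hs := Hodge.Datum.not_isSplit_exampleForm hD
    have := Hodge.Datum.fact_of_not_isSplit hs
    have h2 : (2 : ℚ) ≠ 0 := two_ne_zero
    have hlt : D.etaSO < D.SOext := by
      -- Equality would put the half-turn about the exceptional X into η(SO(V, h)).
      refine lt_of_le_of_ne (Hodge.Datum.etaSO_le_SOext h2 ha) fun heq => ?_
      obtain ⟨X, hX, hXc⟩ := Hodge.Datum.exists_axis_exampleForm hD
      obtain ⟨c, hc0, hc⟩ := Hodge.Datum.exists_pfaffian_eq_zero_of_halfTurn_mem_etaSO h2 ha hX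
        (heq ▸ Hodge.Datum.halfTurn_mem_SOext hX)
      exact hXc c hc0 hc
    exact ⟨ha, hs, (Hodge.Datum.halfTurnGroup_le_etaSO h2 ha).trans_lt hlt, hlt⟩
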